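/- Let $K$ be an algebraically closed field, $\mathbb{P}^k$ the projective space over $K$. A plane curve of degree $d$ is the zero locus $C=V(E)\subset\mathbb{P}^2$ of an irreducible form $E\in K[X_1,X_2,X_3]$ of degree $d$. A curve $C$ is *parameterizable by* a pair $(G_1,G_2)$ of forms in $K[X_1,X_2,X_3]$ of the same degree without common factor if there are forms $u_1,u_2,u_3\in K[T_1,T_2]$ of the same degree without common factor such that $\phi=(u_1:u_2:u_3)$ maps $\mathbb{P}^1$ to $C$ and $\phi$ and the rational map $\psi=(G_1:G_2):C\dashrightarrow\mathbb{P}^1$ are inverse to each other: $\psi(\phi(t))=t$ for almost all $t\in\mathbb{P}^1$ and $\phi(\psi(x))=x$ for almost all $x\in C$. It is *parameterizable by lines* if it is parameterizable by some pair of linear forms. A *quadratic transformation* is a birational map $\mathbb{P}^2\dashrightarrow\mathbb{P}^2$ of the form $(Q_1:Q_2:Q_3)$ with $Q_1,Q_2,Q_3$ forms of degree $2$ without common factor. **Theorem 3.7.** Let $F_1,F_2\in K[X_1,X_2,X_3]$ be forms of degree $2$ without common factor such that $F_1(0,0,1)=F_2(0,0,1)=0$ and such that $T_1F_2(X)-T_2F_1(X)$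 does not define a degenerate conic over the algebraic closure $\overline{K(T_1,T_2)}$, i.e. it is not a product of two linear forms in $X_1,X_2,X_3$ with coefficients in that field. Let $F_3$ be any form of degree $2$ such that $\Lambda_F=(F_1:F_2:F_3):\mathbb{P}^2\dashrightarrow\mathbb{P}^2$ is a quadratic transformation, and let $C$ be a plane curve of degree at least $3$. Then $C$ is parameterizable by $(F_1,F_2)$ if and only if the Zariski closure $\overline{\Lambda_F(C)}$ is a plane curve $C_0$, of some degree $d_0\ge 2$, which is parameterizable by lines, contains $(0:0:1)$ as a point of multiplicity $d_0-1$, and has no singular point other than $(0:0:1)$. (So $(0:0:1)$ is the only singular point of $C_0$ if $d_0\ge3$; if $d_0=2$, then $C_0$ is a smooth conic through $(0:0:1)$.) -/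

import Mathlib

noncomputable section

namespace PlaneRational

open MvPolynomial

variable {K : Type*} [Field K]

/-- The points of the projective space with homogeneous coordinates indexed by `ι`. -/
abbrev Proj (K : Type*) [Field K] (ι : Type) : Type _ := Projectivization K (ι → K)

/-- The point `(0 : 0 : 1)` of the projective plane. -/
def p001 (K : Type*) [Field K] : Proj K (Fin 3) :=
  Projectivization.mk K ![0, 0, 1] (fun h => one_ne_zero (congrFun h 2))

/-- The zero locus in projective space of a homogeneous polynomial. -/
def projZeroLocus {ι : Type} (G : MvPolynomial ι K) : Set (Proj K ι) :=
  {p | eval p.rep G = 0}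

/-- The Zariski closure of a set of points of projective space: the common zeros of all
homogeneous polynomials that vanish on the set. -/
def zariskiClosure {ι : Type} (S : Set (Proj K ι)) : Set (Proj K ι) :=
  {p | ∀ (n : ℕ) (G : MvPolynomial ι K), G.IsHomogeneous n → S ⊆ projZeroLocus G → p ∈ projZeroLocus G}

/-- A family of polynomials has no common factor (other than units). -/
def NoCommonFactor {ι κ : Type} (Q : κ → MvPolynomial ι K) : Prop :=
  ∀ g : MvPolynomial ι K, (∀ i, g ∣ Q i) → IsUnit g

/-- For a tuple `Q` of forms of the same degree, the rational map `p ↦ (Q i (p))ᵢ` is given by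
these forms at the point `p` (that is, not all of them vanish there) and its value is `q`. -/
def RatMapsTo {ι κ : Type} (Q : κ → MvPolynomial ι K) (p : Proj K ι) (q : Proj K κ) : Prop :=
  ∃ h : (fun i => eval p.rep (Q i)) ≠ 0,
    Projectivization.mk K (fun i => eval p.rep (Q i)) h = q

/-- The image of a set of points under the rational map given by `Q`
(the image of the part of the set where the map is defined). -/
def ratImage {ι κ : Type} (Q : κ → MvPolynomial ι K) (S : Set (Proj K ι)) : Set (Proj K κ) :=
  {q | ∃ p ∈ S, RatMapsTo Q p q}

/-- A plane curve: the zero locus of an irreducible homogeneous polynomial of degree `degree`. -/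
structure PlaneCurve (K : Type*) [Field K] where
  poly : MvPolynomial (Fin 3) K
  degree : ℕ
  homogeneous : poly.IsHomogeneous degree
  irreducible : Irreducible poly

namespace PlaneCurve

/-- The points of a plane curve. -/
def points (C : PlaneCurve K) : Set (Proj K (Fin 3)) := projZeroLocus C.poly

/-- The multiplicity of the curve at the point `p`: the order of vanishing of its equation at `p`,
that is, the degree of the lowest nonzero homogeneous part of the Taylor expansion of the equation
at a representative of `p`. It is `0` exactly when `p` is not on the curve. -/
def multiplicity (C : PlaneCurve K) (p : Proj K (Fin 3)) : ℕ :=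
  sInf {m : ℕ | homogeneousComponent m (aeval (fun i => X i + MvPolynomial.C (p.rep i)) C.poly) ≠ 0}

/-- The singular points of the curve: the points of multiplicity at least two. -/
def singularPoints (C : PlaneCurve K) : Set (Proj K (Fin 3)) :=
  {p | 2 ≤ C.multiplicity p}

/-- The curve `C` is parameterizable by `(F₁, F₂)`: these are forms of the same degree without
common factor, and there is a triple `u` of binary forms of the same degree without common factor
which defines a map `φ` from the projective line to `C` such that `φ` and the rational
map `ψ = (F₁ : F₂)` on `C` are inverse to each other, that is,
`ψ (φ t) = t` for almost all `t` in the line and `φ (ψ x) = x` for almost all `x` in `C`. -/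
def ParameterizableBy (C : PlaneCurve K) (F₁ F₂ : MvPolynomial (Fin 3) K) : Prop :=
  (∃ d' : ℕ, F₁.IsHomogeneous d' ∧ F₂.IsHomogeneous d') ∧ NoCommonFactor ![F₁, F₂] ∧
  ∃ (n : ℕ) (u : Fin 3 → MvPolynomial (Fin 2) K),
    (∀ i, (u i).IsHomogeneous n) ∧ NoCommonFactor u ∧
    (∀ (t : Proj K (Fin 2)) (x : Proj K (Fin 3)), RatMapsTo u t x → x ∈ C.points) ∧
    {t : Proj K (Fin 2) | ¬ ∃ x, RatMapsTo u t x ∧ RatMapsTo ![F₁, F₂] x t}.Finite ∧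
    {x : Proj K (Fin 3) | x ∈ C.points ∧
      ¬ ∃ t, RatMapsTo ![F₁, F₂] x t ∧ RatMapsTo u t x}.Finite

/-- The curve is parameterizable by lines: it is parameterizable by some pair of linear forms. -/
def ParameterizableByLines (C : PlaneCurve K) : Prop :=
  ∃ L₁ L₂ : MvPolynomial (Fin 3) K,
    L₁.IsHomogeneous 1 ∧ L₂.IsHomogeneous 1 ∧ C.ParameterizableBy L₁ L₂

end PlaneCurve

/-- The rational self-map of the plane given by a triple `Q` of forms is birational: some triple
`G` of forms of the same degree gives an inverse rational map, so both composed triples are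
proportional to the triple of the variables. -/
def IsBirational (Q : Fin 3 → MvPolynomial (Fin 3) K) : Prop :=
  ∃ (e : ℕ) (G : Fin 3 → MvPolynomial (Fin 3) K), (∀ i, (G i).IsHomogeneous e) ∧
    (∃ H : MvPolynomial (Fin 3) K, H ≠ 0 ∧ ∀ i, aeval Q (G i) = H * X i) ∧
    (∃ H : MvPolynomial (Fin 3) K, H ≠ 0 ∧ ∀ i, aeval G (Q i) = H * X i)

/-- The triple `Q` defines a quadratic transformation of the plane. -/
def IsQuadraticTransformation (Q : Fin 3 → MvPolynomial (Fin 3) K) : Prop :=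
  (∀ i, (Q i).IsHomogeneous 2) ∧ NoCommonFactor Q ∧ IsBirational Q

/-- An algebraic closure of the field `K(T₁, T₂)`. -/
abbrev ClosureKT (K : Type*) [Field K] : Type _ :=
  AlgebraicClosure (FractionRing (MvPolynomial (Fin 2) K))

/-- The embedding of `K[T₁, T₂]` in the algebraic closure of `K(T₁, T₂)`. -/
def toClosureKT (K : Type*) [Field K] : MvPolynomial (Fin 2) K →+* ClosureKT K :=
  (algebraMap (FractionRing (MvPolynomial (Fin 2) K)) (ClosureKT K)).comp
    (algebraMap (MvPolynomial (Fin 2) K) (FractionRing (MvPolynomial (Fin 2) K)))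

/-- The form `T₁ F₂(X) - T₂ F₁(X)` with coefficients in the algebraic closure of `K(T₁, T₂)`. -/
def movingForm (F₁ F₂ : MvPolynomial (Fin 3) K) : MvPolynomial (Fin 3) (ClosureKT K) :=
  C (toClosureKT K (X 0)) * map ((toClosureKT K).comp C) F₂ -
    C (toClosureKT K (X 1)) * map ((toClosureKT K).comp C) F₁

/-- Over an algebraically closed field, a quadratic form in three variables defines a
degenerate conic if it is a product of two linear forms. -/
def IsDegenerateConic {L : Type*} [Field L] (Q : MvPolynomial (Fin 3) L) : Prop :=
  ∃ A B : MvPolynomial (Fin 3) L, A.IsHomogeneous 1 ∧ B.IsHomogeneous 1 ∧ Q = A * B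

end PlaneRational

end

noncomputable section

namespace PlaneRational

open MvPolynomial

variable {K : Type*} [Field K] {σ τ : Type*}

/-! Followed by the projection `(X 0 : X 1)` from (0:0:1), the map Λ_F becomes (F₁ : F₂).
Parametrizations of `C` inverted by (F₁ : F₂) therefore correspond under Λ_F to parametrizations of
the image curve inverted by that projection.

If φ = u parametrizes `C`, the first two entries of F(u) are proportional to (T₁, T₂). After
cancelling common factors F(u) is (T₁a, T₂a, b), so the image is the curve aX₃ = b with `a`, `b`
coprime. Such a curve has multiplicity one less than its degree at (0:0:1), no other singular point,
and projection from (0:0:1) inverts its parametrization (`exists_monoidCurve_of_parameterizableBy`).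
It is not a line, since its equation pulls back to a nonzero multiple of the equation of `C`, of
degree at least 3.

Conversely, multiplicity d₀ - 1 at (0:0:1) makes the equation of `C₀` linear in X₃, say aX₃ + b.
Composing (T₁a, T₂a, -b) with the inverse of Λ_F and cancelling common factors parametrizes `C`
(`parameterizableBy_of_closure_eq`).

"Almost all" is handled by two finiteness facts, proved with heights of prime ideals: a nonzero
binary form has finitely many zeros, and so has a form on a curve whose equation does not divide it.
-/

/-! ### Forms: scaling, factors, cancellation of common factors. -/

/-- A form of degree `n` scales by the `n`-th power. -/
theorem aeval_mul_of_isHomogeneous {A : Type*} [CommRing A] [Algebra K A]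
    {P : MvPolynomial σ K} {n : ℕ} (hP : P.IsHomogeneous n) (c : A) (v : σ → A) :
    aeval (fun i => c * v i) P = c ^ n * aeval v P := by
  rw [aeval_def, aeval_def, eval₂_eq, eval₂_eq, Finset.mul_sum]
  refine Finset.sum_congr rfl fun d hd => ?_
  rw [hP.degree_eq_sum_deg_support hd]
  simp only [mul_pow, Finset.prod_mul_distrib, Finset.prod_pow_eq_pow_sum]
  rw [← Finsupp.degree_apply]
  ring

theorem eval_mul_of_isHomogeneous {P : MvPolynomial σ K} {n : ℕ} (hP : P.IsHomogeneous n)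
    (c : K) (v : σ → K) : eval (fun i => c * v i) P = c ^ n * eval v P := by
  simpa [coe_aeval_eq_eval] using aeval_mul_of_isHomogeneous hP c v

theorem eval_aeval (P : MvPolynomial σ K) (Q : σ → MvPolynomial τ K) (v : τ → K) :
    eval v (aeval Q P) = eval (fun i => eval v (Q i)) P := by
  rw [← coe_aeval_eq_eval, ← coe_aeval_eq_eval, RingHom.coe_coe, RingHom.coe_coe,
    ← AlgHom.comp_apply, comp_aeval]

/-- The substitution `X i ↦ X i * t`, with values in polynomials in the new variable `t`. -/
def scaleHom (K : Type*) [Field K] (σ : Type*) :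
    MvPolynomial σ K →ₐ[K] Polynomial (MvPolynomial σ K) :=
  aeval fun i => Polynomial.X * Polynomial.C (X i)

theorem scaleHom_of_isHomogeneous {P : MvPolynomial σ K} {n : ℕ} (hP : P.IsHomogeneous n) :
    scaleHom K σ P = Polynomial.X ^ n * Polynomial.C P := by
  rw [scaleHom, aeval_mul_of_isHomogeneous hP]
  congr 1
  have : (aeval fun i => Polynomial.C (X i : MvPolynomial σ K)) =
      (Polynomial.CAlgHom : MvPolynomial σ K →ₐ[MvPolynomial σ K] _).restrictScalars K := by
    ext i
    simp
  rw [this]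
  simp

/-- The new variable records the grading, so questions about homogeneity become questions about
degrees of one-variable polynomials. -/
theorem coeff_scaleHom (P : MvPolynomial σ K) (j : ℕ) :
    (scaleHom K σ P).coeff j = homogeneousComponent j P := by
  conv_lhs => rw [← sum_homogeneousComponent P]
  rw [map_sum, Polynomial.finsetSum_coeff]
  simp_rw [scaleHom_of_isHomogeneous (homogeneousComponent_isHomogeneous _ P),
    Polynomial.coeff_X_pow_mul', Polynomial.coeff_C]
  by_cases hj : j < P.totalDegree + 1
  · rw [Finset.sum_eq_single j]
    · simp
    · intro b _ hb
      by_cases h : b ≤ j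
      · rw [if_pos h, if_neg (by omega)]
      · rw [if_neg h]
    · intro h
      exact absurd (Finset.mem_range.2 hj) h
  · rw [homogeneousComponent_eq_zero _ _ (by omega)]
    refine Finset.sum_eq_zero fun b hb => ?_
    rw [Finset.mem_range] at hb
    rw [if_pos (by omega), if_neg (by omega)]

theorem eval_one_scaleHom (P : MvPolynomial σ K) : (scaleHom K σ P).eval 1 = P := by
  have : ((Polynomial.aeval (1 : MvPolynomial σ K)).restrictScalars K).comp (scaleHom K σ) =
      AlgHom.id K _ := by
    ext i
    simp [scaleHom]
  simpa [Polynomial.aeval_def] using DFunLike.congr_fun this P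

/-- A factor of a nonzero form is a form. -/
theorem exists_isHomogeneous_of_mul {f g : MvPolynomial σ K} {n : ℕ}
    (h : (f * g).IsHomogeneous n) (h0 : f * g ≠ 0) : ∃ m, f.IsHomogeneous m := by
  have hmul : scaleHom K σ f * scaleHom K σ g = Polynomial.X ^ n * Polynomial.C (f * g) := by
    rw [← map_mul, scaleHom_of_isHomogeneous h]
  have hne : scaleHom K σ f * scaleHom K σ g ≠ 0 := by
    rw [hmul]
    exact mul_ne_zero (pow_ne_zero _ Polynomial.X_ne_zero) (Polynomial.C_ne_zero.2 h0)
  have hf := left_ne_zero_of_mul hne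
  have hg := right_ne_zero_of_mul hne
  -- The product is a monomial in t, so its degree and trailing degree agree. Both are additive,
  -- hence they agree for each factor, and `f` has a single homogeneous component.
  have h1 := Polynomial.natDegree_mul hf hg
  have h2 := Polynomial.natTrailingDegree_mul hf hg
  rw [hmul, mul_comm] at h1 h2
  rw [Polynomial.natDegree_C_mul_X_pow _ _ h0] at h1
  rw [Polynomial.C_mul_X_pow_eq_monomial, Polynomial.natTrailingDegree_monomial h0] at h2
  have h3 := Polynomial.natTrailingDegree_le_natDegree (scaleHom K σ f)
  have h4 := Polynomial.natTrailingDegree_le_natDegree (scaleHom K σ g)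
  refine ⟨(scaleHom K σ f).natDegree, ?_⟩
  have h5 : f = homogeneousComponent (scaleHom K σ f).natDegree f := by
    conv_lhs => rw [← eval_one_scaleHom f, Polynomial.eval_eq_sum_range]
    rw [Finset.sum_eq_single (scaleHom K σ f).natDegree]
    · rw [coeff_scaleHom]
      simp
    · intro b hb hb'
      rw [Finset.mem_range] at hb
      rw [Polynomial.coeff_eq_zero_of_lt_natTrailingDegree (by omega), zero_mul]
    · intro h
      simp at h
  have h6 := homogeneousComponent_isHomogeneous (scaleHom K σ f).natDegree f
  rwa [← h5] at h6

theorem isHomogeneous_of_mul {f g : MvPolynomial σ K} {m n : ℕ}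
    (h : (f * g).IsHomogeneous (m + n)) (hf : f.IsHomogeneous m) (hf0 : f ≠ 0) :
    g.IsHomogeneous n := by
  by_cases hg : g = 0
  · rw [hg]
    exact isHomogeneous_zero _ _ _
  obtain ⟨k, hk⟩ := exists_isHomogeneous_of_mul (f := g) (g := f) (by rwa [mul_comm])
    (mul_ne_zero hg hf0)
  have := (hf.mul hk).inj_right h (mul_ne_zero hf0 hg)
  rwa [show n = k by omega]

theorem isUnit_of_isHomogeneous_zero {f : MvPolynomial σ K} (h : f.IsHomogeneous 0)
    (h0 : f ≠ 0) : IsUnit f := by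
  have := (totalDegree_zero_iff_isHomogeneous σ).2 h
  rw [totalDegree_eq_zero_iff_eq_C] at this
  rw [this] at h0 ⊢
  exact (isUnit_iff_ne_zero.2 fun h => h0 (by rw [h, C_0])).map C

theorem totalDegree_le_of_dvd {f g : MvPolynomial σ K} (h : f ∣ g) (hg : g ≠ 0) :
    f.totalDegree ≤ g.totalDegree := by
  obtain ⟨k, rfl⟩ := h
  rw [totalDegree_mul_of_isDomain (left_ne_zero_of_mul hg) (right_ne_zero_of_mul hg)]
  omega

theorem isHomogeneous_zero_of_isUnit {f : MvPolynomial σ K} (h : IsUnit f) :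
    f.IsHomogeneous 0 := by
  have := totalDegree_le_of_dvd h.dvd (one_ne_zero (α := MvPolynomial σ K))
  rw [totalDegree_one] at this
  exact (totalDegree_zero_iff_isHomogeneous σ).1 (by omega)

theorem eq_zero_of_dvd_of_lt {f g : MvPolynomial σ K} {m n : ℕ} (hf : f.IsHomogeneous m)
    (hf0 : f ≠ 0) (hg : g.IsHomogeneous n) (h : f ∣ g) (hlt : n < m) : g = 0 := by
  by_contra hg0
  have := totalDegree_le_of_dvd h hg0
  rw [hf.totalDegree hf0, hg.totalDegree hg0] at this
  omega

/-- The common factors of a tuple of forms that are not all zero can be cancelled. -/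
theorem exists_eq_mul_noCommonFactor {ι κ : Type} (n : ℕ) (w : κ → MvPolynomial ι K)
    (hw : ∀ i, (w i).IsHomogeneous n) (h0 : ∃ i, w i ≠ 0) :
    ∃ (k m : ℕ) (g : MvPolynomial ι K) (u : κ → MvPolynomial ι K),
      k + m = n ∧ g.IsHomogeneous k ∧ g ≠ 0 ∧ (∀ i, (u i).IsHomogeneous m) ∧
        NoCommonFactor u ∧ ∀ i, w i = g * u i := by
  induction n using Nat.strong_induction_on generalizing w with
  | _ n ih =>
    by_cases hc : NoCommonFactor w
    · exact ⟨0, n, 1, w, by omega, isHomogeneous_one _ _, one_ne_zero, hw, hc, by simp⟩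
    unfold NoCommonFactor at hc
    push Not at hc
    obtain ⟨f, hf, hfu⟩ := hc
    choose v hv using hf
    obtain ⟨i, hi⟩ := h0
    have hf0 : f ≠ 0 := by
      rintro rfl
      exact hi (by rw [hv i, zero_mul])
    obtain ⟨a, ha⟩ := exists_isHomogeneous_of_mul (f := f) (g := v i) (hv i ▸ hw i) (hv i ▸ hi)
    -- A nonunit factor has positive degree, so the degree drops and the induction applies.
    have ha0 : a ≠ 0 := by
      rintro rfl
      exact hfu (isUnit_of_isHomogeneous_zero ha hf0)
    have han : a ≤ n := by
      have := totalDegree_le_of_dvd ⟨v i, hv i⟩ hi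
      rwa [ha.totalDegree hf0, (hw i).totalDegree hi] at this
    have hvh : ∀ j, (v j).IsHomogeneous (n - a) := fun j =>
      isHomogeneous_of_mul (m := a) (by rw [← hv j, show a + (n - a) = n by omega]; exact hw j)
        ha hf0
    obtain ⟨k, m, g, u, hkm, hg, hg0, hu, huc, hgu⟩ := ih (n - a) (by omega) v hvh
      ⟨i, fun h => hi (by rw [hv i, h, mul_zero])⟩
    exact ⟨a + k, m, f * g, u, by omega, ha.mul hg, mul_ne_zero hf0 hg0, hu, huc, fun j => by
      rw [hv j, hgu j, mul_assoc]⟩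

/-! ### Points of projective space -/

theorem mem_projZeroLocus_mk {ι : Type} {P : MvPolynomial ι K} {n : ℕ} (hP : P.IsHomogeneous n)
    (v : ι → K) (hv : v ≠ 0) : Projectivization.mk K v hv ∈ projZeroLocus P ↔ eval v P = 0 := by
  obtain ⟨a, ha⟩ := Projectivization.exists_smul_eq_mk_rep K v hv
  rw [projZeroLocus, Set.mem_ofPred_eq, ← ha]
  have := eval_mul_of_isHomogeneous hP (a : K) v
  rw [show a • v = fun i => (a : K) * v i from rfl, this]
  simp

/-- `RatMapsTo` evaluates at the chosen representative; another one multiplies all values by the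
same nonzero `n`-th power, so arbitrary coordinates may be used. -/
theorem ratMapsTo_mk_iff {ι κ : Type} {Q : κ → MvPolynomial ι K} {n : ℕ}
    (hQ : ∀ i, (Q i).IsHomogeneous n) (v : ι → K) (hv : v ≠ 0) (w : κ → K) (hw : w ≠ 0) :
    RatMapsTo Q (Projectivization.mk K v hv) (Projectivization.mk K w hw) ↔
      ∃ c : K, c ≠ 0 ∧ ∀ i, eval v (Q i) = c * w i := by
  obtain ⟨a, ha⟩ := Projectivization.exists_smul_eq_mk_rep K v hv
  have key : ∀ i, eval (Projectivization.mk K v hv).rep (Q i) = (a : K) ^ n * eval v (Q i) := by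
    intro i
    rw [← ha]
    exact eval_mul_of_isHomogeneous (hQ i) (a : K) v
  have han : (a : K) ^ n ≠ 0 := pow_ne_zero _ a.ne_zero
  simp only [RatMapsTo, key]
  constructor
  · rintro ⟨h, hmk⟩
    rw [Projectivization.mk_eq_mk_iff'] at hmk
    obtain ⟨c, hc⟩ := hmk
    refine ⟨((a : K) ^ n)⁻¹ * c, mul_ne_zero (inv_ne_zero han) ?_, fun i => ?_⟩
    · rintro rfl
      apply h
      rw [← hc, zero_smul]
    · have := congrFun hc i
      simp only [Pi.smul_apply, smul_eq_mul] at this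
      rw [mul_assoc, this, inv_mul_cancel_left₀ han]
  · rintro ⟨c, hc, h⟩
    have hne : (fun i => (a : K) ^ n * eval v (Q i)) ≠ 0 := by
      intro h0
      apply hw
      funext i
      have := congrFun h0 i
      rw [h i] at this
      simpa [hc] using this
    refine ⟨hne, ?_⟩
    rw [Projectivization.mk_eq_mk_iff']
    refine ⟨(a : K) ^ n * c, ?_⟩
    funext i
    simp [h i, mul_assoc]

theorem mk_eq_mk_of_mul {κ : Type} {v w : κ → K} (hv : v ≠ 0) (hw : w ≠ 0) (c : K)
    (h : ∀ i, v i = c * w i) : Projectivization.mk K v hv = Projectivization.mk K w hw := by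
  rw [Projectivization.mk_eq_mk_iff']
  exact ⟨c, funext fun i => (h i).symm⟩

/-! ### Finiteness of zero sets through heights of point ideals. -/

/-- The homogeneous prime ideal of the point with coordinates `v`. -/
def pointIdeal {ι : Type} (v : ι → K) : Ideal (MvPolynomial ι K) :=
  RingHom.ker (aeval fun i => Polynomial.C (v i) * Polynomial.X :
    MvPolynomial ι K →ₐ[K] Polynomial K)

instance pointIdeal_isPrime {ι : Type} (v : ι → K) : (pointIdeal v).IsPrime :=
  RingHom.ker_isPrime _

theorem mem_pointIdeal_iff {ι : Type} {P : MvPolynomial ι K} {n : ℕ} (hP : P.IsHomogeneous n)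
    (v : ι → K) : P ∈ pointIdeal v ↔ eval v P = 0 := by
  have h : aeval (fun i => Polynomial.C (v i) * Polynomial.X) P =
      Polynomial.X ^ n * Polynomial.C (eval v P) := by
    simp_rw [mul_comm (Polynomial.C _)]
    rw [aeval_mul_of_isHomogeneous hP]
    congr 1
    have : (aeval fun i => Polynomial.C (v i)) = (Polynomial.CAlgHom : K →ₐ[K] _).comp (aeval v) := by
      ext i
      simp
    rw [this]
    simp
  rw [pointIdeal, RingHom.mem_ker, h]
  simp

/-- A point is determined by the linear forms vanishing at it. -/
theorem eq_of_linear_forms {ι : Type} {p q : Proj K ι}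
    (h : ∀ P : MvPolynomial ι K, P.IsHomogeneous 1 → p ∈ projZeroLocus P → q ∈ projZeroLocus P) :
    p = q := by
  obtain ⟨i, hi⟩ : ∃ i, p.rep i ≠ 0 := by
    by_contra! hc
    exact p.rep_nonzero (funext hc)
  rw [← p.mk_rep, ← q.mk_rep]
  refine (mk_eq_mk_of_mul _ _ (q.rep i * (p.rep i)⁻¹) fun j => ?_).symm
  have h1 : eval q.rep (C (p.rep j) * X i - C (p.rep i) * X j) = 0 :=
    h _ ((isHomogeneous_C_mul_X _ _).sub (isHomogeneous_C_mul_X _ _)) (by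
      simp [projZeroLocus, mul_comm])
  simp only [map_sub, map_mul, eval_C, eval_X] at h1
  field_simp
  linear_combination -h1

theorem pointIdeal_injective {ι : Type} {p q : Proj K ι}
    (h : pointIdeal p.rep = pointIdeal q.rep) : p = q :=
  eq_of_linear_forms fun _ hP hp =>
    (mem_pointIdeal_iff hP _).1 (h ▸ (mem_pointIdeal_iff hP _).2 hp)

theorem pointIdeal_lt_ker {ι : Type} {v : ι → K} (hv : v ≠ 0) :
    pointIdeal v < RingHom.ker (constantCoeff : MvPolynomial ι K →+* K) := by
  obtain ⟨i, hi⟩ : ∃ i, v i ≠ 0 := by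
    by_contra! hc
    exact hv (funext hc)
  refine lt_of_le_of_ne (fun P hP => ?_) fun h => ?_
  · rw [pointIdeal, RingHom.mem_ker] at hP
    rw [RingHom.mem_ker]
    have h2 : (Polynomial.aeval (0 : K)).comp
        (aeval fun i => Polynomial.C (v i) * Polynomial.X : MvPolynomial ι K →ₐ[K] Polynomial K) =
        aeval (0 : ι → K) := by
      ext j
      simp
    have h3 := DFunLike.congr_fun h2 P
    rw [AlgHom.comp_apply] at h3
    erw [hP] at h3
    rw [map_zero, aeval_zero] at h3
    simpa using h3.symm
  · have : (X i : MvPolynomial ι K) ∈ pointIdeal v := by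
      rw [h, RingHom.mem_ker]
      simp
    rw [mem_pointIdeal_iff (isHomogeneous_X _ _)] at this
    simp [hi] at this

/-- The ideal of a projective point lies strictly below the ideal of the origin, whose height is at
most the dimension `k` of the ring. -/
theorem height_pointIdeal_add_one_le {k : ℕ} {v : Fin k → K} (hv : v ≠ 0) :
    (pointIdeal v).height + 1 ≤ k := by
  have : (RingHom.ker (constantCoeff : MvPolynomial (Fin k) K →+* K)).IsPrime :=
    RingHom.ker_isPrime _
  have h1 := Ideal.height_add_one_le_of_lt_of_isPrime (pointIdeal_lt_ker hv)
  refine h1.trans ?_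
  have h2 := Ideal.height_le_ringKrullDim_of_isPrime
    (I := RingHom.ker (constantCoeff : MvPolynomial (Fin k) K →+* K))
  rw [MvPolynomial.ringKrullDim_of_isNoetherianRing, ringKrullDim_eq_zero_of_field, zero_add,
    Nat.card_fin] at h2
  exact_mod_cast h2

/-- An ideal of height at least `k` in `k + 1` variables vanishes at finitely many points. -/
theorem finite_setOf_le_pointIdeal {k : ℕ} (I : Ideal (MvPolynomial (Fin (k + 1)) K))
    (hI : (k : ℕ∞) ≤ I.height) : {p : Proj K (Fin (k + 1)) | I ≤ pointIdeal p.rep}.Finite := by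
  have hfin := I.finite_minimalPrimes_of_isNoetherianRing
  refine Set.Finite.of_finite_image (f := fun p => pointIdeal p.rep) (hfin.subset ?_)
    fun p _ q _ h => pointIdeal_injective h
  rintro _ ⟨p, hp, rfl⟩
  have h1 := height_pointIdeal_add_one_le p.rep_nonzero
  have h2 : (pointIdeal p.rep).height ≤ k := by
    push_cast at h1
    exact (ENat.add_le_add_iff_right ENat.one_ne_top).1 h1
  have : (pointIdeal p.rep).FiniteHeight := ⟨Or.inr (ne_top_of_le_ne_top (ENat.natCast_ne_top k) h2)⟩
  -- A prime over `I` of height at most that of `I` is minimal over `I`, and there are finitely many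
  -- minimal primes.
  exact Ideal.mem_minimalPrimes_of_height_le hp (h2.trans hI)

/-- A nonzero binary form has finitely many zeros on the projective line. -/
theorem finite_projZeroLocus {P : MvPolynomial (Fin 2) K} {n : ℕ} (hP : P.IsHomogeneous n)
    (h0 : P ≠ 0) : (projZeroLocus P).Finite := by
  refine (finite_setOf_le_pointIdeal (k := 1) (Ideal.span {P}) ?_).subset fun p hp => ?_
  · have : (Ideal.span {P}).height ≠ 0 := by
      rw [Ne, Ideal.height_eq_zero_iff_eq_bot]
      simpa using h0
    exact_mod_cast Order.one_le_iff_ne_zero.2 this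
  · rw [Set.mem_ofPred_eq, Ideal.span_singleton_le_iff_mem, mem_pointIdeal_iff hP]
    exact hp

/-- A plane curve and a form not divisible by its equation have finitely many common zeros. -/
theorem finite_inter_projZeroLocus {P Q : MvPolynomial (Fin 3) K} {m n : ℕ}
    (hP : P.IsHomogeneous m) (hirr : Irreducible P) (hQ : Q.IsHomogeneous n) (h : ¬ P ∣ Q) :
    (projZeroLocus P ∩ projZeroLocus Q).Finite := by
  refine (finite_setOf_le_pointIdeal (k := 2) (Ideal.span {P, Q}) ?_).subset fun p hp => ?_
  · rw [Ideal.height_eq_inf_minimalPrimes]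
    refine le_iInf₂ fun J hJ => ?_
    have := hJ.1.1
    have hPJ : P ∈ J := hJ.1.2 (Ideal.subset_span (by simp))
    have hQJ : Q ∈ J := hJ.1.2 (Ideal.subset_span (by simp))
    have hpr : (Ideal.span {P}).IsPrime := by
      rw [Ideal.span_singleton_prime hirr.ne_zero]
      exact hirr.prime
    -- The chain 0 < (P) < J shows that `J` has height at least 2; the second inclusion is strict
    -- because `Q` lies in `J` but not in (P).
    have h1 : (⊥ : Ideal (MvPolynomial (Fin 3) K)) < Ideal.span {P} := by
      rw [bot_lt_iff_ne_bot, Ne, Ideal.span_singleton_eq_bot]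
      exact hirr.ne_zero
    have h2 : Ideal.span {P} < J := by
      refine lt_of_le_of_ne ((Ideal.span_singleton_le_iff_mem _).2 hPJ) fun he => h ?_
      rw [← Ideal.mem_span_singleton, he]
      exact hQJ
    have h3 := Ideal.height_add_one_le_of_lt_of_isPrime h1
    have h4 := Ideal.height_add_one_le_of_lt_of_isPrime h2
    rw [Ideal.height_bot, zero_add] at h3
    refine le_trans ?_ h4
    have := add_le_add_left h3 1
    simpa [one_add_one_eq_two] using this
  · rw [Set.mem_ofPred_eq, Ideal.span_le]
    rintro _ (rfl | rfl)
    · exact (mem_pointIdeal_iff hP _).2 hp.1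
    · exact (mem_pointIdeal_iff hQ _).2 hp.2

/-! ### Infinite sets of points and forms vanishing on them. -/

theorem RatMapsTo.unique {ι κ : Type} {Q : κ → MvPolynomial ι K} {p : Proj K ι} {q q' : Proj K κ}
    (h : RatMapsTo Q p q) (h' : RatMapsTo Q p q') : q = q' := by
  obtain ⟨_, rfl⟩ := h
  obtain ⟨_, rfl⟩ := h'
  rfl

/-- Used with `R a b` meaning that a rational map sends `b` to `a`: the injectivity condition is
then single-valuedness, and infinitely many values force infinitely many arguments. -/
theorem infinite_of_rel {A B : Type*} {D : Set A} {T : Set B} (hD : D.Infinite)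
    (R : A → B → Prop) (h : ∀ a ∈ D, ∃ b ∈ T, R a b)
    (hinj : ∀ a a' b, R a b → R a' b → a = a') : T.Infinite := by
  obtain ⟨a₀, ha₀⟩ := hD.nonempty
  have : Nonempty B := ⟨(h a₀ ha₀).choose⟩
  choose! f hf hR using h
  refine Set.infinite_of_injOn_mapsTo (f := f) (fun a ha a' ha' haa => ?_) hf hD
  refine hinj a a' (f a) (hR a ha) ?_
  rw [haa]
  exact hR a' ha'

instance infinite_projectiveLine [Infinite K] : Infinite (Proj K (Fin 2)) := by
  refine Infinite.of_injective (fun s : K => Projectivization.mk K ![1, s]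
    (fun h => one_ne_zero (congrFun h 0))) fun s s' h => ?_
  obtain ⟨c, hc⟩ := (Projectivization.mk_eq_mk_iff' _ _ _ _ _).1 h
  have h0 : c = 1 := by simpa using congrFun hc 0
  simpa [h0] using (congrFun hc 1).symm

theorem eq_zero_of_infinite [Infinite K] {P : MvPolynomial (Fin 2) K} {n : ℕ}
    (hP : P.IsHomogeneous n) {T : Set (Proj K (Fin 2))} (hT : T.Infinite)
    (h : T ⊆ projZeroLocus P) : P = 0 := by
  by_contra h0
  exact hT ((finite_projZeroLocus hP h0).subset h)

theorem PlaneCurve.dvd_of_infinite (C : PlaneCurve K) {Q : MvPolynomial (Fin 3) K} {n : ℕ}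
    (hQ : Q.IsHomogeneous n) {T : Set (Proj K (Fin 3))} (hT : T.Infinite)
    (hC : T ⊆ C.points) (h : T ⊆ projZeroLocus Q) : C.poly ∣ Q := by
  by_contra h0
  exact hT ((finite_inter_projZeroLocus C.homogeneous C.irreducible hQ h0).subset
    (Set.subset_inter hC h))

theorem PlaneCurve.finite_inter (C : PlaneCurve K) {Q : MvPolynomial (Fin 3) K} {n : ℕ}
    (hQ : Q.IsHomogeneous n) (h : ¬ C.poly ∣ Q) : (C.points ∩ projZeroLocus Q).Finite :=
  finite_inter_projZeroLocus C.homogeneous C.irreducible hQ h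

theorem projZeroLocus_subset_of_dvd {ι : Type} {P Q : MvPolynomial ι K} (h : P ∣ Q) :
    projZeroLocus P ⊆ projZeroLocus Q := by
  obtain ⟨k, rfl⟩ := h
  intro p hp
  have hp' : eval p.rep P = 0 := hp
  change eval p.rep (P * k) = 0
  rw [map_mul, hp', zero_mul]

theorem mem_projZeroLocus_of_ratMapsTo {ι κ : Type} {Q : κ → MvPolynomial ι K} {n k : ℕ}
    (hQ : ∀ i, (Q i).IsHomogeneous n) {P : MvPolynomial κ K} (hP : P.IsHomogeneous k)
    {p : Proj K ι} {q : Proj K κ} (h : RatMapsTo Q p q) :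
    q ∈ projZeroLocus P ↔ p ∈ projZeroLocus (aeval Q P) := by
  induction p using Projectivization.ind with | _ v hv
  induction q using Projectivization.ind with | _ w hw
  obtain ⟨c, hc, h⟩ := (ratMapsTo_mk_iff hQ v hv w hw).1 h
  rw [mem_projZeroLocus_mk hP, mem_projZeroLocus_mk (hP.aeval Q hQ), eval_aeval, funext h,
    eval_mul_of_isHomogeneous hP]
  simp [hc]

/-! ### Closures -/

theorem exists_linear_form_separating {ι : Type} {p q : Proj K ι} (h : p ≠ q) :
    ∃ P : MvPolynomial ι K, P.IsHomogeneous 1 ∧ p ∈ projZeroLocus P ∧ q ∉ projZeroLocus P := by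
  by_contra! hc
  exact h (eq_of_linear_forms hc)

/-- A point outside `S` is separated from it by a product of linear forms, one through each point of
`S`. Hence a set with infinite closure is infinite. -/
theorem zariskiClosure_finite_subset {ι : Type} {S : Set (Proj K ι)} (hS : S.Finite) :
    zariskiClosure S ⊆ S := by
  intro q hq
  by_contra hqS
  have hsep : ∀ p ∈ S, ∃ P : MvPolynomial ι K,
      P.IsHomogeneous 1 ∧ p ∈ projZeroLocus P ∧ q ∉ projZeroLocus P := fun p hp =>
    exists_linear_form_separating fun h => hqS (h ▸ hp)
  choose! P hP hpP hqP using hsep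
  have hm : ∀ p : Proj K ι, p ∈ hS.toFinset → p ∈ S := fun p hp => hS.mem_toFinset.1 hp
  have h1 := hq _ (∏ p ∈ hS.toFinset, P p)
    (IsHomogeneous.prod _ _ (fun _ => 1) fun p hp => hP p (hm p hp)) fun p hp =>
      projZeroLocus_subset_of_dvd (Finset.dvd_prod_of_mem P (hS.mem_toFinset.2 hp)) (hpP p hp)
  have h2 : eval q.rep (∏ p ∈ hS.toFinset, P p) = 0 := h1
  rw [map_prod, Finset.prod_eq_zero_iff] at h2
  obtain ⟨p, hp, h3⟩ := h2
  exact hqP p (hm p hp) h3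

theorem subset_zariskiClosure {ι : Type} (S : Set (Proj K ι)) : S ⊆ zariskiClosure S :=
  fun _ hp _ _ _ h => h hp

theorem PlaneCurve.ParameterizableBy.infinite_points [Infinite K] {C : PlaneCurve K}
    {F₁ F₂ : MvPolynomial (Fin 3) K} (h : C.ParameterizableBy F₁ F₂) : C.points.Infinite := by
  obtain ⟨-, -, n, u, -, -, hu, hfin, -⟩ := h
  refine infinite_of_rel hfin.infinite_compl (fun t x => RatMapsTo ![F₁, F₂] x t)
    (fun t ht => ?_) fun t t' x h h' => h.unique h'
  obtain ⟨x, hx, hx'⟩ := not_not.1 ht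
  exact ⟨x, hu t x hx, hx'⟩

/-! ### Binary forms -/

/-- A binary form is divisible by the linear form of each of its zeros. -/
theorem linear_dvd_of_eval_eq_zero {P : MvPolynomial (Fin 2) K} {n : ℕ} (hP : P.IsHomogeneous n)
    {s : Fin 2 → K} (hs : s ≠ 0) (h : eval s P = 0) :
    (C (s 1) * X 0 - C (s 0) * X 1 : MvPolynomial (Fin 2) K) ∣ P := by
  set l : MvPolynomial (Fin 2) K := C (s 1) * X 0 - C (s 0) * X 1 with hl
  obtain ⟨j, hj⟩ : ∃ i, s i ≠ 0 := by
    by_contra! hc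
    exact hs (funext hc)
  -- Modulo `l` the vector of variables is proportional to `s`, that is, s_j X_i = X_j s_i.
  -- Homogeneity gives s_j^n P(X) = X_j^n P(s) = 0, with s_j a unit.
  let q := Ideal.Quotient.mkₐ K (Ideal.span {l})
  have hq0 : q l = 0 := Ideal.Quotient.eq_zero_iff_mem.2 (Ideal.mem_span_singleton_self l)
  have hq : algebraMap K _ (s 1) * q (X 0) = algebraMap K _ (s 0) * q (X 1) := by
    have h0 : q (C (s 1) * X 0 - C (s 0) * X 1) = 0 := hq0
    simp only [map_sub, map_mul] at h0
    rw [← algebraMap_eq, AlgHom.commutes, AlgHom.commutes] at h0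
    exact sub_eq_zero.1 h0
  have h1 : (fun i => algebraMap K _ (s j) * q (X i)) = fun i => q (X j) * algebraMap K _ (s i) := by
    funext i
    fin_cases i <;> fin_cases j <;> simp only [Fin.zero_eta, Fin.mk_one] <;>
      first | exact mul_comm _ _ | rw [hq, mul_comm] | rw [← hq, mul_comm]
  have h2 := aeval_mul_of_isHomogeneous hP (algebraMap K _ (s j)) (fun i => q (X i))
  rw [h1, aeval_mul_of_isHomogeneous hP] at h2
  have h3 : aeval (fun i => algebraMap K (MvPolynomial (Fin 2) K ⧸ Ideal.span {l}) (s i)) P = 0 := by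
    have := aeval_algebraMap_apply (MvPolynomial (Fin 2) K ⧸ Ideal.span {l}) s P
    rw [show (algebraMap K _ ∘ s) = fun i => algebraMap K
      (MvPolynomial (Fin 2) K ⧸ Ideal.span {l}) (s i) from rfl] at this
    rw [this, aeval_eq_eval, h, map_zero]
  have h4 : aeval (fun i => q (X i)) P = q P := by
    have : aeval (fun i => q (X i)) = q := by
      ext i
      simp
    rw [this]
  rw [h3, mul_zero, h4] at h2
  have h5 : q P = 0 := by
    have hu : IsUnit (algebraMap K (MvPolynomial (Fin 2) K ⧸ Ideal.span {l}) (s j) ^ n) :=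
      ((isUnit_iff_ne_zero.2 hj).map _).pow n
    exact (hu.mul_right_eq_zero).1 h2.symm
  exact Ideal.mem_span_singleton.1 (Ideal.Quotient.eq_zero_iff_mem.1 h5)

theorem not_isUnit_linear (s : Fin 2 → K) :
    ¬ IsUnit (C (s 1) * X 0 - C (s 0) * X 1 : MvPolynomial (Fin 2) K) := by
  intro h
  have h1 := h.map (eval s)
  simp [mul_comm] at h1

theorem X_zero_dvd_of_mul_eq {ι : Type} {i j : ι} (hij : i ≠ j) {A B : MvPolynomial ι K}
    (h : X j * A = X i * B) : X i ∣ A := by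
  refine ((X_prime (i := i)).dvd_or_dvd (a := X j) ⟨B, h⟩).resolve_left fun hd => hij ?_
  rw [X_dvd_X] at hd
  simp_all

/-! ### Ternary forms as polynomials in the last variable -/

/-- Polynomials in three variables as polynomials in the last one. -/
def lastEquiv (K : Type*) [Field K] :
    MvPolynomial (Fin 3) K ≃ₐ[K] Polynomial (MvPolynomial (Fin 2) K) :=
  -- `finSuccEquiv` singles out index 0; the rotation moves index 2 there and keeps the order of the
  -- other two.
  (renameEquiv K (finRotate 3)).trans (finSuccEquiv K 2)

theorem lastEquiv_X_two : lastEquiv K (X 2) = Polynomial.X := by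
  rw [lastEquiv, AlgEquiv.trans_apply, renameEquiv_apply, rename_X,
    show finRotate 3 2 = 0 from rfl, finSuccEquiv_X_zero]

theorem lastEquiv_rename (a : MvPolynomial (Fin 2) K) :
    lastEquiv K (rename Fin.castSucc a) = Polynomial.C a := by
  have : (lastEquiv K).toAlgHom.comp (rename Fin.castSucc) =
      (Polynomial.CAlgHom : MvPolynomial (Fin 2) K →ₐ[MvPolynomial (Fin 2) K] _).restrictScalars
        K := by
    refine algHom_ext fun i => ?_
    change finSuccEquiv K 2 (rename (finRotate 3) (rename Fin.castSucc (X i))) =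
      Polynomial.C (X i)
    rw [← finSuccEquiv_X_succ, rename_X, rename_X]
    fin_cases i <;> rfl
  exact DFunLike.congr_fun this a

theorem eq_sum_lastEquiv (E : MvPolynomial (Fin 3) K) :
    E = ∑ j ∈ Finset.range ((lastEquiv K E).natDegree + 1),
      rename Fin.castSucc ((lastEquiv K E).coeff j) * X 2 ^ j := by
  apply (lastEquiv K).injective
  conv_lhs => rw [Polynomial.as_sum_range_C_mul_X_pow (lastEquiv K E)]
  rw [map_sum]
  refine Finset.sum_congr rfl fun j _ => ?_
  rw [map_mul, map_pow, lastEquiv_X_two, lastEquiv_rename]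

theorem lastEquiv_coeff_isHomogeneous {E : MvPolynomial (Fin 3) K} {n i j : ℕ}
    (hE : E.IsHomogeneous n) (h : i + j = n) : ((lastEquiv K E).coeff i).IsHomogeneous j :=
  IsHomogeneous.finSuccEquiv_coeff_isHomogeneous (hE.rename_isHomogeneous (f := finRotate 3)) i j h

theorem natDegree_lastEquiv_le {E : MvPolynomial (Fin 3) K} {n : ℕ} (hE : E.IsHomogeneous n) :
    (lastEquiv K E).natDegree ≤ n := by
  rw [lastEquiv, AlgEquiv.trans_apply, natDegree_finSuccEquiv]
  exact (degreeOf_le_totalDegree _ _).trans (hE.rename_isHomogeneous (f := finRotate 3)).totalDegree_le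

/-- The form `a(X₀, X₁) X₂ + b(X₀, X₁)`. -/
def monoidForm (a b : MvPolynomial (Fin 2) K) : MvPolynomial (Fin 3) K :=
  rename Fin.castSucc a * X 2 + rename Fin.castSucc b

theorem monoidForm_isHomogeneous {a b : MvPolynomial (Fin 2) K} {m : ℕ} (ha : a.IsHomogeneous m)
    (hb : b.IsHomogeneous (m + 1)) : (monoidForm a b).IsHomogeneous (m + 1) :=
  (ha.rename_isHomogeneous.mul (isHomogeneous_X _ _)).add hb.rename_isHomogeneous

theorem eval_monoidForm (a b : MvPolynomial (Fin 2) K) (y : Fin 3 → K) :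
    eval y (monoidForm a b) = eval ![y 0, y 1] a * y 2 + eval ![y 0, y 1] b := by
  have : y ∘ Fin.castSucc = ![y 0, y 1] := by
    funext i
    fin_cases i <;> rfl
  simp only [monoidForm, map_add, map_mul, eval_rename, eval_X, this]

theorem aeval_monoidForm {A : Type*} [CommRing A] [Algebra K A] (a b : MvPolynomial (Fin 2) K)
    (y : Fin 3 → A) :
    aeval y (monoidForm a b) = aeval ![y 0, y 1] a * y 2 + aeval ![y 0, y 1] b := by
  have : y ∘ Fin.castSucc = ![y 0, y 1] := by
    funext i
    fin_cases i <;> rfl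
  simp only [monoidForm, map_add, map_mul, aeval_rename, aeval_X, this]

theorem lastEquiv_monoidForm (a b : MvPolynomial (Fin 2) K) :
    lastEquiv K (monoidForm a b) = Polynomial.C a * Polynomial.X + Polynomial.C b := by
  rw [monoidForm, map_add, map_mul, lastEquiv_rename, lastEquiv_rename, lastEquiv_X_two]

/-! ### Multiplicities -/

theorem exists_rep_p001 : ∃ c : K, c ≠ 0 ∧ (p001 K).rep = ![0, 0, c] := by
  obtain ⟨a, ha⟩ := Projectivization.exists_smul_eq_mk_rep K (![0, 0, 1] : Fin 3 → K)
    (fun h => one_ne_zero (congrFun h 2))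
  refine ⟨a, a.ne_zero, ?_⟩
  rw [p001, ← ha]
  funext i
  fin_cases i <;> simp [Units.smul_def]

/-- The multiplicity at `(0 : 0 : 1)` is the difference between the degree of the curve and the
degree of its equation in the last variable. -/
theorem PlaneCurve.multiplicity_p001_add (C₀ : PlaneCurve K) :
    C₀.multiplicity (p001 K) + (lastEquiv K C₀.poly).natDegree = C₀.degree := by
  obtain ⟨c, hc, hrep⟩ := exists_rep_p001 (K := K)
  set p := lastEquiv K C₀.poly with hp
  have hle : p.natDegree ≤ C₀.degree := natDegree_lastEquiv_le C₀.homogeneous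
  have hp0 : p ≠ 0 := by
    rw [hp, Ne, EmbeddingLike.map_eq_zero_iff]
    exact C₀.irreducible.ne_zero
  -- If e_j, a form of degree d - j, is the coefficient of X₃^j, the expansion at (0,0,c) is the sum
  -- of e_j (X₃ + c)^j. Summand j starts in degree d - j with c^j e_j, so the lowest part comes from
  -- the largest j.
  have hcomp : ∀ k, homogeneousComponent k
      (aeval (fun i => X i + MvPolynomial.C ((p001 K).rep i)) C₀.poly) =
      ∑ j ∈ Finset.range (p.natDegree + 1), if C₀.degree - j ≤ k then
        ((Polynomial.X * Polynomial.C (X 2) + Polynomial.C (C c)) ^ j *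
          Polynomial.C (rename Fin.castSucc (p.coeff j)) :
          Polynomial (MvPolynomial (Fin 3) K)).coeff (k - (C₀.degree - j)) else 0 := by
    intro k
    rw [← coeff_scaleHom]
    conv_lhs => rw [eq_sum_lastEquiv C₀.poly]
    rw [map_sum, map_sum, Polynomial.finsetSum_coeff]
    refine Finset.sum_congr rfl fun j hj => ?_
    rw [Finset.mem_range] at hj
    have h1 : aeval (fun i => X i + MvPolynomial.C ((p001 K).rep i))
        (rename Fin.castSucc (p.coeff j)) = rename Fin.castSucc (p.coeff j) := by
      have : (fun i => X i + C ((p001 K).rep i)) ∘ Fin.castSucc =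
          fun i => (X (Fin.castSucc i) : MvPolynomial (Fin 3) K) := by
        funext i
        rw [hrep]
        fin_cases i <;> simp
      rw [aeval_rename, this]
      conv_rhs => rw [← aeval_X_left_apply (p.coeff j), ← AlgHom.comp_apply, comp_aeval]
      simp only [rename_X]
    have h2 : scaleHom K (Fin 3) (X 2 + C c) =
        Polynomial.X * Polynomial.C (X 2) + Polynomial.C (C c) := by
      rw [scaleHom, map_add, aeval_X, ← algebraMap_eq, AlgHom.commutes]
      rfl
    rw [map_mul, map_pow, aeval_X, ← hp, h1, map_mul, map_pow, scaleHom_of_isHomogeneous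
      (lastEquiv_coeff_isHomogeneous C₀.homogeneous
        (show j + (C₀.degree - j) = _ by omega)).rename_isHomogeneous, hrep,
      show (![0, 0, c] : Fin 3 → K) 2 = c from rfl, h2, mul_assoc,
      Polynomial.coeff_X_pow_mul', mul_comm (Polynomial.C _)]
  have hmem : homogeneousComponent (C₀.degree - p.natDegree)
      (aeval (fun i => X i + MvPolynomial.C ((p001 K).rep i)) C₀.poly) ≠ 0 := by
    rw [hcomp, Finset.sum_eq_single p.natDegree]
    · rw [if_pos le_rfl, Nat.sub_self, Polynomial.coeff_zero_eq_eval_zero]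
      simp only [Polynomial.eval_mul, Polynomial.eval_pow, Polynomial.eval_add, Polynomial.eval_X,
        Polynomial.eval_C, zero_mul, zero_add]
      refine mul_ne_zero (pow_ne_zero _ (C_ne_zero.2 hc)) ?_
      rw [Ne, (rename_injective _ (Fin.castSucc_injective 2)).eq_iff' (map_zero _)]
      simpa using hp0
    · intro j hj hne
      rw [Finset.mem_range] at hj
      rw [if_neg (by omega)]
    · intro h
      simp at h
  have hlow : ∀ k < C₀.degree - p.natDegree, homogeneousComponent k
      (aeval (fun i => X i + MvPolynomial.C ((p001 K).rep i)) C₀.poly) = 0 := by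
    intro k hk
    rw [hcomp]
    refine Finset.sum_eq_zero fun j hj => ?_
    rw [Finset.mem_range] at hj
    rw [if_neg (by omega)]
  have : C₀.multiplicity (p001 K) = C₀.degree - p.natDegree := by
    refine le_antisymm (Nat.sInf_le hmem) (le_csInf ⟨_, hmem⟩ fun k hk => ?_)
    by_contra! hlt
    exact hk (hlow k hlt)
  omega

/-- At a singular point the restriction of the equation to a line vanishes to order two. -/
theorem PlaneCurve.coeff_eq_zero_of_mem_singularPoints (C₀ : PlaneCurve K) {p : Proj K (Fin 3)}
    (hp : p ∈ C₀.singularPoints) (v : Fin 3 → K) {j : ℕ} (hj : j < 2) :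
    (aeval (fun i => Polynomial.X * Polynomial.C (v i) + Polynomial.C (p.rep i))
      C₀.poly).coeff j = 0 := by
  have h1 : ((Polynomial.mapAlgHom (aeval v)).comp (scaleHom K (Fin 3))).comp
      (aeval (fun i => X i + MvPolynomial.C (p.rep i))) =
      aeval (fun i => Polynomial.X * Polynomial.C (v i) + Polynomial.C (p.rep i)) := by
    ext1 i
    simp only [AlgHom.comp_apply, aeval_X, map_add]
    rw [← algebraMap_eq, AlgHom.commutes, AlgHom.commutes]
    simp [scaleHom]
  rw [← h1, AlgHom.comp_apply, AlgHom.comp_apply, Polynomial.coe_mapAlgHom, Polynomial.coeff_map,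
    coeff_scaleHom]
  have h2 : homogeneousComponent j (aeval (fun i => X i + MvPolynomial.C (p.rep i)) C₀.poly) = 0 := by
    by_contra h
    have h3 : C₀.multiplicity p ≤ j := Nat.sInf_le h
    have h4 : 2 ≤ C₀.multiplicity p := hp
    omega
  rw [h2, map_zero]

/-- Substituting the inverse `G` into the pullback of `P` gives H^n P, which is nonzero. -/
theorem aeval_ne_zero_of_isBirational {F : Fin 3 → MvPolynomial (Fin 3) K} (hF : IsBirational F)
    {P : MvPolynomial (Fin 3) K} {n : ℕ} (hP : P.IsHomogeneous n) (h0 : P ≠ 0) :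
    aeval F P ≠ 0 := by
  obtain ⟨e, G, -, -, H, hH0, hH⟩ := hF
  intro h
  have h1 : aeval (fun i => aeval G (F i)) P = 0 := by
    rw [← comp_aeval_apply, h, map_zero]
  rw [show (fun i => aeval G (F i)) = fun i => H * X i from funext hH,
    aeval_mul_of_isHomogeneous hP, aeval_X_left_apply] at h1
  exact mul_ne_zero (pow_ne_zero _ hH0) h0 h1

theorem isHomogeneous_pair {ι : Type} {F₁ F₂ : MvPolynomial ι K} {n : ℕ}
    (h₁ : F₁.IsHomogeneous n) (h₂ : F₂.IsHomogeneous n) (i : Fin 2) :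
    (![F₁, F₂] i).IsHomogeneous n := by
  fin_cases i
  exacts [h₁, h₂]

theorem noCommonFactor_X : NoCommonFactor ![(X 0 : MvPolynomial (Fin 3) K), X 1] := by
  intro g hg
  have h0 : g ∣ X 0 := hg 0
  have h1 : g ∣ X 1 := hg 1
  by_contra hu
  have h2 := (X_prime (R := K) (i := (0 : Fin 3))).irreducible.dvd_iff.1 h0
  have h3 := (h2.resolve_left hu).dvd.trans h1
  rw [X_dvd_X] at h3
  simp_all

/-! ### Monoid curves with their standard parametrization -/

/-- By homogeneity both terms become a^(m+1) b. -/
theorem aeval_param_monoidForm {a b : MvPolynomial (Fin 2) K} {m : ℕ} (ha : a.IsHomogeneous m)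
    (hb : b.IsHomogeneous (m + 1)) :
    aeval ![X 0 * a, X 1 * a, b] (monoidForm a (-b)) = 0 := by
  have h1 : (![X 0 * a, X 1 * a] : Fin 2 → MvPolynomial (Fin 2) K) = fun i => a * X i := by
    funext i
    fin_cases i <;> exact mul_comm _ _
  rw [aeval_monoidForm]
  simp only [Matrix.cons_val_zero, Matrix.cons_val_one, Matrix.cons_val]
  rw [h1, aeval_mul_of_isHomogeneous ha, aeval_mul_of_isHomogeneous hb.neg, aeval_X_left_apply,
    aeval_X_left_apply]
  ring

theorem isHomogeneous_param {a b : MvPolynomial (Fin 2) K} {m : ℕ} (ha : a.IsHomogeneous m)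
    (hb : b.IsHomogeneous (m + 1)) (i : Fin 3) :
    ((![X 0 * a, X 1 * a, b] : Fin 3 → MvPolynomial (Fin 2) K) i).IsHomogeneous (m + 1) := by
  have h : ∀ j : Fin 2, (X j * a).IsHomogeneous (m + 1) := fun j => by
    rw [add_comm]
    exact (isHomogeneous_X _ _).mul ha
  fin_cases i
  exacts [h 0, h 1, hb]

/-- A common zero would give a common linear factor. -/
theorem noCommonZero {a b : MvPolynomial (Fin 2) K} {m : ℕ} (ha : a.IsHomogeneous m)
    (hb : b.IsHomogeneous (m + 1)) (hcop : NoCommonFactor ![X 0 * a, X 1 * a, b])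
    {s : Fin 2 → K} (hs : s ≠ 0) (h : eval s a = 0) : eval s b ≠ 0 := by
  intro h'
  refine not_isUnit_linear s (hcop _ fun i => ?_)
  have h1 := linear_dvd_of_eval_eq_zero ha hs h
  have h2 := linear_dvd_of_eval_eq_zero hb hs h'
  fin_cases i
  exacts [h1.mul_left _, h1.mul_left _, h2]

/-- The polynomial is linear in `X 2`, so only a common factor `d` of its coefficients matters.
Setting `X 2` to 0 turns `d` into a common factor in two variables, hence a unit; as `d` is a form,
it has degree 0. -/
theorem irreducible_monoidForm {a b : MvPolynomial (Fin 2) K} {m : ℕ} (ha : a.IsHomogeneous m)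
    (ha0 : a ≠ 0) (hcop : NoCommonFactor ![X 0 * a, X 1 * a, b]) :
    Irreducible (monoidForm a (-b)) := by
  classical
  have hinj := rename_injective (R := K) _ (Fin.castSucc_injective 2)
  have hvars : ∀ c : MvPolynomial (Fin 2) K, (2 : Fin 3) ∉ (rename Fin.castSucc c).vars := by
    intro c hc
    have := vars_rename (Fin.castSucc (n := 2)) c hc
    rw [Finset.mem_image] at this
    obtain ⟨i, -, hi⟩ := this
    fin_cases i <;> simp [Fin.ext_iff] at hi
  have hra : rename Fin.castSucc a ≠ 0 := by rwa [Ne, hinj.eq_iff' (map_zero _)]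
  refine irreducible_mul_X_add _ _ 2 hra (hvars a) (hvars _) fun d hda hdb => ?_
  let ρ : MvPolynomial (Fin 3) K →ₐ[K] MvPolynomial (Fin 2) K := aeval ![X 0, X 1, 0]
  have hρ : ∀ c, ρ (rename Fin.castSucc c) = c := by
    intro c
    have : (![X 0, X 1, 0] : Fin 3 → MvPolynomial (Fin 2) K) ∘ Fin.castSucc = X := by
      funext i
      fin_cases i <;> rfl
    rw [aeval_rename, this, aeval_X_left_apply]
  have h1 : ρ d ∣ a := hρ a ▸ map_dvd ρ hda
  have h2 : ρ d ∣ b := by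
    have := hρ (-b) ▸ map_dvd ρ hdb
    rwa [dvd_neg] at this
  have h3 : IsUnit (ρ d) := by
    refine hcop _ fun i => ?_
    fin_cases i
    exacts [h1.mul_left _, h1.mul_left _, h2]
  obtain ⟨k, hk⟩ := hda
  obtain ⟨l, hl⟩ := exists_isHomogeneous_of_mul (f := d) (g := k)
    (hk ▸ ha.rename_isHomogeneous) (hk ▸ hra)
  have h4 : (ρ d).IsHomogeneous (1 * l) := hl.aeval _ fun i => by
    fin_cases i
    exacts [isHomogeneous_X _ _, isHomogeneous_X _ _, isHomogeneous_zero _ _ _]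
  have h5 := h4.inj_right (isHomogeneous_zero_of_isUnit h3) h3.ne_zero
  obtain rfl : l = 0 := by omega
  exact isUnit_of_isHomogeneous_zero hl (left_ne_zero_of_mul (hk ▸ hra))

/-- The curve `a(X₀, X₁) X₂ = b(X₀, X₁)`. -/
def monoidCurve {a b : MvPolynomial (Fin 2) K} {m : ℕ} (ha : a.IsHomogeneous m)
    (hb : b.IsHomogeneous (m + 1)) (ha0 : a ≠ 0)
    (hcop : NoCommonFactor ![X 0 * a, X 1 * a, b]) : PlaneCurve K where
  poly := monoidForm a (-b)
  degree := m + 1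
  homogeneous := monoidForm_isHomogeneous ha hb.neg
  irreducible := irreducible_monoidForm ha ha0 hcop

section monoidCurve

variable {a b : MvPolynomial (Fin 2) K} {m : ℕ} (ha : a.IsHomogeneous m)
  (hb : b.IsHomogeneous (m + 1)) (ha0 : a ≠ 0) (hcop : NoCommonFactor ![X 0 * a, X 1 * a, b])

theorem monoidCurve_multiplicity :
    (monoidCurve ha hb ha0 hcop).multiplicity (p001 K) = m := by
  have h1 := (monoidCurve ha hb ha0 hcop).multiplicity_p001_add
  have h2 : (lastEquiv K (monoidCurve ha hb ha0 hcop).poly).natDegree = 1 := by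
    change (lastEquiv K (monoidForm a (-b))).natDegree = 1
    rw [lastEquiv_monoidForm, Polynomial.natDegree_linear ha0]
  rw [h2] at h1
  exact Nat.succ.inj h1

/-- For positive `m` both forms vanish at the origin; for `m = 0` the curve is a line missing this
point. -/
theorem p001_mem_monoidCurve (hm : m ≠ 0) : p001 K ∈ (monoidCurve ha hb ha0 hcop).points := by
  have hz : (![0, 0] : Fin 2 → K) = fun i => 0 * (0 : Fin 2 → K) i := by
    funext i
    fin_cases i <;> simp
  refine (mem_projZeroLocus_mk (monoidCurve ha hb ha0 hcop).homogeneous _ _).2 ?_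
  change eval _ (monoidForm a (-b)) = 0
  rw [eval_monoidForm]
  simp only [Matrix.cons_val_zero, Matrix.cons_val_one]
  rw [hz, eval_mul_of_isHomogeneous ha, eval_mul_of_isHomogeneous hb.neg]
  simp [hm]

theorem eq_p001_of_eq_zero {y : Fin 3 → K} (hy : y ≠ 0) (h : ![y 0, y 1] = 0) :
    Projectivization.mk K y hy = p001 K := by
  have h0 := congrFun h 0
  have h1 := congrFun h 1
  refine mk_eq_mk_of_mul _ _ (y 2) fun i => ?_
  fin_cases i
  · simpa using h0
  · simpa using h1
  · simp

/-- On the line joining `p` to (0:0:1) the equation is a(s)(t + p₃) - b(s). Vanishing to order two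
would make `s` a common zero of `a` and `b`. -/
theorem monoidCurve_singularPoints :
    (monoidCurve ha hb ha0 hcop).singularPoints ⊆ {p001 K} := by
  intro p hp
  rw [Set.mem_singleton_iff]
  by_contra hne
  have hs : ![p.rep 0, p.rep 1] ≠ 0 := fun h => hne (by
    rw [← eq_p001_of_eq_zero p.rep_nonzero h, p.mk_rep])
  have key : aeval (fun i => Polynomial.X * Polynomial.C ((![0, 0, 1] : Fin 3 → K) i) +
      Polynomial.C (p.rep i)) (monoidCurve ha hb ha0 hcop).poly =
      Polynomial.C (eval ![p.rep 0, p.rep 1] a) * (Polynomial.X + Polynomial.C (p.rep 2)) +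
      Polynomial.C (eval ![p.rep 0, p.rep 1] (-b)) := by
    have h1 : ∀ c : MvPolynomial (Fin 2) K,
        aeval ![Polynomial.C (p.rep 0), Polynomial.C (p.rep 1)] c =
          Polynomial.C (eval ![p.rep 0, p.rep 1] c) := by
      intro c
      have := aeval_algebraMap_apply (Polynomial K) ![p.rep 0, p.rep 1] c
      rw [aeval_eq_eval] at this
      rw [← Polynomial.algebraMap_eq, ← this]
      congr 2
      funext i
      fin_cases i <;> rfl
    change aeval _ (monoidForm a (-b)) = _
    rw [aeval_monoidForm]
    simp only [Matrix.cons_val_zero, Matrix.cons_val_one, Matrix.cons_val, map_zero, mul_zero,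
      zero_add, map_one, mul_one, h1]
  have h0 := PlaneCurve.coeff_eq_zero_of_mem_singularPoints _ hp ![0, 0, 1] (j := 0) (by omega)
  have h1 := PlaneCurve.coeff_eq_zero_of_mem_singularPoints _ hp ![0, 0, 1] (j := 1) (by omega)
  rw [key] at h0 h1
  simp only [mul_add, Polynomial.coeff_add, Polynomial.coeff_C_mul, Polynomial.coeff_X_zero,
    Polynomial.coeff_X_one, Polynomial.coeff_C_zero, Polynomial.coeff_C_succ, mul_zero, mul_one,
    zero_add, add_zero] at h0 h1
  refine noCommonZero ha hb hcop hs h1 ?_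
  rw [h1] at h0
  simpa using h0

/-- Projection from (0:0:1) is the inverse. The exceptions are among the zeros of `a` on the line
and (0:0:1) on the curve. -/
theorem monoidCurve_parameterizableByLines :
    (monoidCurve ha hb ha0 hcop).ParameterizableByLines := by
  have hu := isHomogeneous_param ha hb
  have hX := isHomogeneous_pair (isHomogeneous_X K (0 : Fin 3)) (isHomogeneous_X K (1 : Fin 3))
  refine ⟨X 0, X 1, isHomogeneous_X _ _, isHomogeneous_X _ _, ⟨1, isHomogeneous_X _ _,
    isHomogeneous_X _ _⟩, noCommonFactor_X, m + 1, _, hu, hcop, fun t x h => ?_, ?_, ?_⟩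
  · refine (mem_projZeroLocus_of_ratMapsTo hu (monoidCurve ha hb ha0 hcop).homogeneous h).2 ?_
    change eval t.rep (aeval _ (monoidForm a (-b))) = 0
    rw [aeval_param_monoidForm ha hb, map_zero]
  · refine (finite_projZeroLocus ha ha0).subset fun t ht => ?_
    by_contra hat
    refine ht ?_
    induction t using Projectivization.ind with | _ s hs
    rw [mem_projZeroLocus_mk ha] at hat
    have hy : ![s 0 * eval s a, s 1 * eval s a, eval s b] ≠ 0 := by
      intro h
      have h0 := congrFun h 0
      have h1 := congrFun h 1
      refine hs (funext fun i => ?_)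
      fin_cases i
      · simpa [hat] using h0
      · simpa [hat] using h1
    refine ⟨Projectivization.mk K _ hy, ?_, ?_⟩
    · refine (ratMapsTo_mk_iff hu _ _ _ _).2 ⟨1, one_ne_zero, fun i => ?_⟩
      fin_cases i <;> simp
    · refine (ratMapsTo_mk_iff hX _ _ _ _).2 ⟨eval s a, hat, fun i => ?_⟩
      fin_cases i <;> simp [mul_comm]
  · refine (Set.finite_singleton (p001 K)).subset fun x hx => ?_
    obtain ⟨hxC, hx⟩ := hx
    by_contra hne
    refine hx ?_
    induction x using Projectivization.ind with | _ y hy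
    have hs : ![y 0, y 1] ≠ 0 := fun h => hne (eq_p001_of_eq_zero hy h)
    have h1 : eval y (monoidForm a (-b)) = 0 :=
      (mem_projZeroLocus_mk (monoidCurve ha hb ha0 hcop).homogeneous _ _).1 hxC
    rw [eval_monoidForm, map_neg] at h1
    have h2 : eval ![y 0, y 1] a ≠ 0 := by
      intro h
      refine noCommonZero ha hb hcop hs h ?_
      rw [h] at h1
      simpa using h1
    refine ⟨Projectivization.mk K _ hs, ?_, ?_⟩
    · refine (ratMapsTo_mk_iff hX _ _ _ _).2 ⟨1, one_ne_zero, fun i => ?_⟩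
      fin_cases i <;> simp
    · refine (ratMapsTo_mk_iff hu _ _ _ _).2 ⟨_, h2, fun i => ?_⟩
      fin_cases i
      · simp [mul_comm]
      · simp [mul_comm]
      · simp
        linear_combination -h1

end monoidCurve

/-! ### From a parametrization to the image curve -/

theorem exists_monoidCurve_of_parameterizableBy [Infinite K]
    {F : Fin 3 → MvPolynomial (Fin 3) K} (hF : ∀ i, (F i).IsHomogeneous 2) (hbir : IsBirational F)
    (C : PlaneCurve K) (hC : 3 ≤ C.degree) (h : C.ParameterizableBy (F 0) (F 1)) :
    ∃ C₀ : PlaneCurve K,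
      C₀.ParameterizableByLines ∧ p001 K ∈ C₀.points ∧
      C₀.multiplicity (p001 K) + 1 = C₀.degree ∧ C₀.singularPoints ⊆ {p001 K} ∧
      zariskiClosure (ratImage F C.points) = C₀.points := by
  obtain ⟨-, -, n, u, hu, -, huC, hfin, -⟩ := h
  set T := {t : Proj K (Fin 2) | ∃ x, RatMapsTo u t x ∧ RatMapsTo ![F 0, F 1] x t} with hT
  have hTfin : Tᶜ.Finite := hfin
  have hTinf : T.Infinite := by simpa using hTfin.infinite_compl
  have hFp := isHomogeneous_pair (hF 0) (hF 1)
  -- A form that vanishes on the parametrization vanishes at infinitely many points of `C`.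
  have hdvd : ∀ (Q : MvPolynomial (Fin 3) K) (k : ℕ), Q.IsHomogeneous k → aeval u Q = 0 →
      C.poly ∣ Q := by
    intro Q k hQ hQ0
    have hinf : (C.points ∩ projZeroLocus Q).Infinite := by
      refine infinite_of_rel hTinf (fun t x => RatMapsTo ![F 0, F 1] x t) (fun t ht => ?_)
        fun t t' x h h' => h.unique h'
      obtain ⟨x, hx, hx'⟩ := ht
      refine ⟨x, ⟨huC t x hx, (mem_projZeroLocus_of_ratMapsTo hu hQ hx).2 ?_⟩, hx'⟩
      rw [hQ0]
      exact map_zero _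
    exact C.dvd_of_infinite hQ hinf Set.inter_subset_left Set.inter_subset_right
  set w : Fin 3 → MvPolynomial (Fin 2) K := fun i => aeval u (F i) with hw
  have hwh : ∀ i, (w i).IsHomogeneous (n * 2) := fun i => (hF i).aeval u hu
  have hwT : ∀ (s : Fin 2 → K) (hs : s ≠ 0), Projectivization.mk K s hs ∈ T →
      (∃ c : K, c ≠ 0 ∧ eval s (w 0) = c * s 0 ∧ eval s (w 1) = c * s 1) ∧
      ∃ (y : Fin 3 → K) (hy : y ≠ 0) (c : K), c ≠ 0 ∧ Projectivization.mk K y hy ∈ C.points ∧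
        ∀ i, eval y (F i) = c * eval s (w i) := by
    rintro s hs ⟨x, hx, hx'⟩
    have hxC := huC _ _ hx
    induction x using Projectivization.ind with | _ y hy
    obtain ⟨c, hc, h1⟩ := (ratMapsTo_mk_iff hu _ _ _ _).1 hx
    obtain ⟨d, hd, h2⟩ := (ratMapsTo_mk_iff hFp _ _ _ _).1 hx'
    have h3 : ∀ i, eval s (w i) = c ^ 2 * eval y (F i) := fun i => by
      rw [hw, eval_aeval, funext h1, eval_mul_of_isHomogeneous (hF i)]
    have h20 : eval y (F 0) = d * s 0 := h2 0
    have h21 : eval y (F 1) = d * s 1 := h2 1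
    refine ⟨⟨c ^ 2 * d, mul_ne_zero (pow_ne_zero _ hc) hd, ?_, ?_⟩, y, hy, (c ^ 2)⁻¹,
      inv_ne_zero (pow_ne_zero _ hc), hxC, fun i => ?_⟩
    · rw [h3, h20, mul_assoc]
    · rw [h3, h21, mul_assoc]
    · rw [h3, inv_mul_cancel_left₀ (pow_ne_zero _ hc)]
  have hw01 : X 1 * w 0 = X 0 * w 1 := by
    rw [← sub_eq_zero]
    refine eq_zero_of_infinite (((isHomogeneous_X _ _).mul (hwh 0)).sub
      ((isHomogeneous_X _ _).mul (hwh 1))) hTinf fun t ht => ?_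
    induction t using Projectivization.ind with | _ s hs
    obtain ⟨⟨c, -, h0, h1⟩, -⟩ := hwT s hs ht
    rw [mem_projZeroLocus_mk (((isHomogeneous_X _ _).mul (hwh 0)).sub
      ((isHomogeneous_X _ _).mul (hwh 1)))]
    simp only [map_sub, map_mul, eval_X, h0, h1]
    ring
  have hw0 : w 0 ≠ 0 ∨ w 1 ≠ 0 := by
    by_contra! hc
    obtain ⟨t, ht⟩ := hTinf.nonempty
    induction t using Projectivization.ind with | _ s hs
    obtain ⟨⟨c, hc0, h0, h1⟩, -⟩ := hwT s hs ht
    rw [hc.1, map_zero, eq_comm, mul_eq_zero] at h0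
    rw [hc.2, map_zero, eq_comm, mul_eq_zero] at h1
    refine hs (funext fun i => ?_)
    fin_cases i
    exacts [h0.resolve_left hc0, h1.resolve_left hc0]
  -- The common factor `g` has to go before (T₁a, T₂a, b) can give an irreducible equation.
  obtain ⟨k, N, g, w', -, hg, hg0, hw'h, hcop, hgw⟩ := exists_eq_mul_noCommonFactor _ w hwh
    (hw0.elim (fun h => ⟨0, h⟩) fun h => ⟨1, h⟩)
  have hw'01 : X 1 * w' 0 = X 0 * w' 1 := by
    refine mul_left_cancel₀ hg0 ?_
    rw [hgw, hgw] at hw01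
    linear_combination hw01
  obtain ⟨a, ha⟩ := X_zero_dvd_of_mul_eq (by decide) hw'01
  have ha1 : w' 1 = X 1 * a := by
    refine mul_left_cancel₀ (X_ne_zero (0 : Fin 2)) ?_
    rw [← hw'01, ha]
    ring
  have ha0 : a ≠ 0 := by
    rintro rfl
    rw [hgw, hgw, ha, ha1] at hw0
    simp at hw0
  have hXa : X 0 * a ≠ 0 := mul_ne_zero (X_ne_zero _) ha0
  have hw'0 : (X 0 * a).IsHomogeneous N := ha ▸ hw'h 0
  obtain ⟨m, hm⟩ := exists_isHomogeneous_of_mul (f := a) (g := X 0) (by rwa [mul_comm])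
    (by rwa [mul_comm])
  obtain rfl : N = m + 1 := by
    rw [add_comm]
    exact hw'0.inj_right ((isHomogeneous_X _ _).mul hm) hXa
  set b := w' 2 with hb
  have hw'eq : w' = ![X 0 * a, X 1 * a, b] := by
    funext i
    fin_cases i
    exacts [ha, ha1, rfl]
  have hbh : b.IsHomogeneous (m + 1) := hw'h 2
  have hPw : aeval w' (monoidForm a (-b)) = 0 := by
    rw [hw'eq]
    exact aeval_param_monoidForm hm hbh
  have hPh := monoidForm_isHomogeneous hm hbh.neg
  rw [hw'eq] at hcop
  have hPF : C.poly ∣ aeval F (monoidForm a (-b)) := by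
    refine hdvd _ _ (hPh.aeval F hF) ?_
    rw [comp_aeval_apply]
    change aeval w _ = 0
    rw [funext hgw, aeval_mul_of_isHomogeneous hPh, hPw, mul_zero]
  -- For `m = 0` the pulled-back equation would be a nonzero form of degree 2 divisible by an
  -- equation of degree at least 3.
  have hm0 : m ≠ 0 := by
    rintro rfl
    refine aeval_ne_zero_of_isBirational hbir hPh (irreducible_monoidForm hm ha0 hcop).ne_zero ?_
    exact eq_zero_of_dvd_of_lt C.homogeneous C.irreducible.ne_zero (hPh.aeval F hF) hPF (by omega)
  refine ⟨monoidCurve hm hbh ha0 hcop, monoidCurve_parameterizableByLines _ _ _ _,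
    p001_mem_monoidCurve _ _ _ _ hm0, by rw [monoidCurve_multiplicity]; rfl,
    monoidCurve_singularPoints _ _ _ _, Set.Subset.antisymm (fun q hq => ?_) fun q hq => ?_⟩
  · refine hq _ _ hPh fun q' hq' => ?_
    obtain ⟨p, hp, hpq⟩ := hq'
    exact (mem_projZeroLocus_of_ratMapsTo hF hPh hpq).2 (projZeroLocus_subset_of_dvd hPF hp)
  · intro k Q hQ hsub
    refine projZeroLocus_subset_of_dvd ?_ hq
    -- Away from the zeros of `g * a`, the value of `w'` is a point of the monoid curve lying in the
    -- image of `C`; distinct parameters give distinct points. A form vanishing on the image thus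
    -- vanishes at infinitely many points of that curve.
    have hTinf' : (T \ projZeroLocus (g * a)).Infinite :=
      hTinf.sdiff (finite_projZeroLocus (hg.mul hm) (mul_ne_zero hg0 ha0))
    have hX := isHomogeneous_pair (isHomogeneous_X K (0 : Fin 3)) (isHomogeneous_X K (1 : Fin 3))
    have hinf : ((monoidCurve hm hbh ha0 hcop).points ∩ projZeroLocus Q).Infinite := by
      refine infinite_of_rel hTinf' (fun t x => RatMapsTo ![X 0, X 1] x t) (fun t ht => ?_)
        fun t t' x h h' => h.unique h'
      obtain ⟨htT, htg⟩ := ht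
      induction t using Projectivization.ind with | _ s hs
      rw [mem_projZeroLocus_mk (hg.mul hm), map_mul, mul_eq_zero, not_or] at htg
      obtain ⟨-, y, hy, c, hc, hyC, hyF⟩ := hwT s hs htT
      have hz : (fun i => eval s (w' i)) ≠ 0 := by
        intro h
        refine hs (funext fun i => ?_)
        have h0 := congrFun h 0
        have h1 := congrFun h 1
        simp only [ha, ha1, map_mul, eval_X, Pi.zero_apply, mul_eq_zero, htg.2, or_false] at h0 h1
        fin_cases i
        exacts [h0, h1]
      refine ⟨Projectivization.mk K _ hz, ⟨?_, hsub ⟨_, hyC, ?_⟩⟩, ?_⟩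
      · refine (mem_projZeroLocus_mk hPh _ _).2 ?_
        rw [← eval_aeval, hPw, map_zero]
      · refine (ratMapsTo_mk_iff hF _ _ _ _).2 ⟨c * eval s g, mul_ne_zero hc htg.1, fun i => ?_⟩
        rw [hyF, hgw, map_mul, mul_assoc]
      · refine (ratMapsTo_mk_iff hX _ _ _ _).2 ⟨eval s a, htg.2, fun i => ?_⟩
        fin_cases i
        · simp [ha, mul_comm]
        · simp [ha1, mul_comm]
    exact (monoidCurve hm hbh ha0 hcop).dvd_of_infinite hQ hinf Set.inter_subset_left
      Set.inter_subset_right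

/-! ### From the image curve to a parametrization -/

/-- Coprimality of the inverse triple ensures that not all its entries vanish on the image curve. -/
theorem exists_inverse_noCommonFactor {F : Fin 3 → MvPolynomial (Fin 3) K}
    (hF : ∀ i, (F i).IsHomogeneous 2) (hbir : IsBirational F) :
    ∃ (e k : ℕ) (G : Fin 3 → MvPolynomial (Fin 3) K) (H : MvPolynomial (Fin 3) K),
      (∀ i, (G i).IsHomogeneous e) ∧ NoCommonFactor G ∧ H.IsHomogeneous k ∧ H ≠ 0 ∧
      ∀ i, aeval F (G i) = H * X i := by
  obtain ⟨e, G, hG, ⟨H, hH0, hH⟩, -⟩ := hbir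
  have hHX : ∀ i, H * X i ≠ 0 := fun i => mul_ne_zero hH0 (X_ne_zero i)
  have hG0 : G 0 ≠ 0 := by
    intro h
    apply hHX 0
    rw [← hH, h, map_zero]
  obtain ⟨-, m, g, G', -, -, hg0, hG', hcop, hgG⟩ := exists_eq_mul_noCommonFactor _ G hG ⟨0, hG0⟩
  have hmul : ∀ i, aeval F g * aeval F (G' i) = H * X i := fun i => by
    rw [← map_mul, ← hgG, hH]
  have hFg : aeval F g ≠ 0 := fun h => hHX 0 (by rw [← hmul, h, zero_mul])
  -- After cancellation the composite is still proportional to the variables; primality of `X 0`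
  -- then yields a polynomial factor `H'`.
  have hsymm : ∀ i, X i * aeval F (G' 0) = X 0 * aeval F (G' i) := fun i => by
    refine mul_left_cancel₀ hFg ?_
    linear_combination (X i : MvPolynomial (Fin 3) K) * hmul 0 - X 0 * hmul i
  obtain ⟨H', hH'⟩ := X_zero_dvd_of_mul_eq (by decide) (hsymm 1)
  have hH'i : ∀ i, aeval F (G' i) = H' * X i := fun i => by
    refine mul_left_cancel₀ (X_ne_zero (0 : Fin 3)) ?_
    rw [← hsymm, hH']
    ring
  have hne : H' * X 0 ≠ 0 := by
    intro h
    apply hHX 0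
    rw [← hmul, hH'i, h, mul_zero]
  obtain ⟨k, hk⟩ := exists_isHomogeneous_of_mul (f := H') (g := X 0)
    (hH'i 0 ▸ (hG' 0).aeval F hF) hne
  exact ⟨m, k, G', H', hG', hcop, hk, left_ne_zero_of_mul hne, hH'i⟩

/-- The degree in `X 2` is the total degree minus the multiplicity, here 1. -/
theorem exists_eq_monoidForm (C₀ : PlaneCurve K)
    (h : C₀.multiplicity (p001 K) + 1 = C₀.degree) :
    ∃ (m : ℕ) (a b : MvPolynomial (Fin 2) K), a.IsHomogeneous m ∧ b.IsHomogeneous (m + 1) ∧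
      a ≠ 0 ∧ C₀.degree = m + 1 ∧ C₀.poly = monoidForm a b := by
  have h1 := C₀.multiplicity_p001_add
  have h2 : (lastEquiv K C₀.poly).natDegree = 1 := by omega
  refine ⟨C₀.multiplicity (p001 K), (lastEquiv K C₀.poly).coeff 1, (lastEquiv K C₀.poly).coeff 0,
    lastEquiv_coeff_isHomogeneous C₀.homogeneous (by omega),
    lastEquiv_coeff_isHomogeneous C₀.homogeneous (by omega), ?_, h.symm, ?_⟩
  · rw [← h2, Polynomial.coeff_natDegree, Ne, Polynomial.leadingCoeff_eq_zero]
    intro h0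
    rw [h0] at h2
    simp at h2
  · conv_lhs => rw [eq_sum_lastEquiv C₀.poly, h2]
    simp [Finset.sum_range_succ, monoidForm, add_comm]

theorem parameterizableBy_of_closure_eq [Infinite K]
    {F : Fin 3 → MvPolynomial (Fin 3) K} (hF : ∀ i, (F i).IsHomogeneous 2) (hbir : IsBirational F)
    (hcopF : NoCommonFactor ![F 0, F 1]) (C : PlaneCurve K) (hC : 3 ≤ C.degree)
    (C₀ : PlaneCurve K) (hinf₀ : C₀.points.Infinite)
    (hmult : C₀.multiplicity (p001 K) + 1 = C₀.degree)
    (hcl : zariskiClosure (ratImage F C.points) = C₀.points) :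
    C.ParameterizableBy (F 0) (F 1) := by
  obtain ⟨m, a, b, ha, hb, ha0, hdeg, hE⟩ := exists_eq_monoidForm C₀ hmult
  obtain ⟨e, k, G, H, hG, hGcop, hHh, hH0, hGF⟩ := exists_inverse_noCommonFactor hF hbir
  have hsub : ratImage F C.points ⊆ C₀.points := hcl ▸ subset_zariskiClosure _
  have himg : (ratImage F C.points).Infinite := fun h =>
    hinf₀ (h.subset (hcl ▸ zariskiClosure_finite_subset h))
  have hFp := isHomogeneous_pair (hF 0) (hF 1)
  have hCinf : C.points.Infinite :=
    infinite_of_rel himg (fun q p => RatMapsTo F p q) (fun q hq => hq)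
      fun q q' p h h' => h.unique h'
  have hlift : ∀ (Q : MvPolynomial (Fin 3) K) (l : ℕ), Q.IsHomogeneous l →
      C.poly ∣ aeval F Q → C₀.poly ∣ Q := by
    intro Q l hQ hd
    refine C₀.dvd_of_infinite hQ himg hsub fun q hq => ?_
    obtain ⟨p, hp, hpq⟩ := hq
    exact (mem_projZeroLocus_of_ratMapsTo hF hQ hpq).2 (projZeroLocus_subset_of_dvd hd hp)
  -- If `H` vanished on `C`, so would every pullback of `G i`, and the equation of `C₀` would be a
  -- common factor of `G`.
  have hHC : ¬ C.poly ∣ H := fun h => C₀.irreducible.not_isUnit (hGcop _ fun i =>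
    hlift _ _ (hG i) (by rw [hGF]; exact h.mul_right _))
  have hra : (rename Fin.castSucc a : MvPolynomial (Fin 3) K).IsHomogeneous m :=
    ha.rename_isHomogeneous
  have haC : ¬ C.poly ∣ aeval F (rename Fin.castSucc a) := fun h => by
    have h1 := eq_zero_of_dvd_of_lt C₀.homogeneous C₀.irreducible.ne_zero hra
      (hlift _ _ hra h) (by omega)
    rw [(rename_injective _ (Fin.castSucc_injective 2)).eq_iff' (map_zero _)] at h1
    exact ha0 h1
  have hF0 : F 0 ≠ 0 := by
    have := aeval_ne_zero_of_isBirational hbir (isHomogeneous_X K (0 : Fin 3)) (X_ne_zero _)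
    rwa [aeval_X] at this
  have hFC : ¬ C.poly ∣ F 0 := fun h =>
    hF0 (eq_zero_of_dvd_of_lt C.homogeneous C.irreducible.ne_zero (hF 0) h (by omega))
  -- Off this finite set (F₁ : F₂) is defined, `G` inverts Λ_F, and the parametrization of `C₀` is
  -- nonzero at the projected point.
  set B : Set (Proj K (Fin 3)) := C.points ∩ projZeroLocus H ∪
    C.points ∩ projZeroLocus (aeval F (rename Fin.castSucc a)) ∪ C.points ∩ projZeroLocus (F 0)
    with hB
  have hBfin : B.Finite := ((C.finite_inter hHh hHC).union
    (C.finite_inter (hra.aeval F hF) haC)).union (C.finite_inter (hF 0) hFC)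
  have hDinf : (C.points \ B).Infinite := hCinf.sdiff hBfin
  set u₀ : Fin 3 → MvPolynomial (Fin 2) K := ![X 0 * a, X 1 * a, -b] with hu₀
  have hu₀h : ∀ i, (u₀ i).IsHomogeneous (m + 1) := isHomogeneous_param ha hb.neg
  set v : Fin 3 → MvPolynomial (Fin 2) K := fun i => aeval u₀ (G i) with hv
  have hvh : ∀ i, (v i).IsHomogeneous ((m + 1) * e) := fun i => (hG i).aeval u₀ hu₀h
  -- For `z` on `C` the point F(z) satisfies aX₃ + b = 0, so `u₀` at (F₁(z), F₂(z)) is a multiple of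
  -- F(z), and `G` returns it to a multiple of `z`.
  have key : ∀ (z : Fin 3 → K) (hz : z ≠ 0), Projectivization.mk K z hz ∈ C.points \ B →
      eval z (F 0) ≠ 0 ∧ ∃ c : K, c ≠ 0 ∧
        ∀ i, eval ![eval z (F 0), eval z (F 1)] (v i) = c * z i := by
    rintro z hz ⟨hzC, hzB⟩
    simp only [hB, Set.mem_union, Set.mem_inter_iff, hzC, true_and, not_or] at hzB
    rw [mem_projZeroLocus_mk hHh, mem_projZeroLocus_mk (hF 0),
      mem_projZeroLocus_mk (hra.aeval F hF), eval_aeval, eval_rename] at hzB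
    obtain ⟨⟨hzH, hza⟩, hz0⟩ := hzB
    refine ⟨hz0, ?_⟩
    have hcomp : (fun i => eval z (F i)) ∘ Fin.castSucc = ![eval z (F 0), eval z (F 1)] := by
      funext i
      fin_cases i <;> rfl
    rw [hcomp] at hza
    have hy : (fun i => eval z (F i)) ≠ 0 := fun h => hz0 (congrFun h 0)
    have hyC : Projectivization.mk K _ hy ∈ C₀.points := by
      refine hsub ⟨_, hzC, (ratMapsTo_mk_iff hF _ _ _ _).2 ⟨1, one_ne_zero, fun i => ?_⟩⟩
      rw [one_mul]
    have hy0 := (mem_projZeroLocus_mk C₀.homogeneous _ _).1 hyC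
    rw [hE, eval_monoidForm] at hy0
    have hu₀y : (fun i => eval ![eval z (F 0), eval z (F 1)] (u₀ i)) =
        fun i => eval ![eval z (F 0), eval z (F 1)] a * eval z (F i) := by
      funext i
      fin_cases i
      · simp [hu₀, mul_comm]
      · simp [hu₀, mul_comm]
      · simp only [hu₀, Fin.reduceFinMk, Matrix.cons_val, map_neg]
        linear_combination -hy0
    refine ⟨_, mul_ne_zero (pow_ne_zero e hza) hzH, fun i => ?_⟩
    rw [hv, eval_aeval, hu₀y, eval_mul_of_isHomogeneous (hG i), ← eval_aeval, hGF, map_mul,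
      eval_X, mul_assoc]
  have hv0 : ∃ i, v i ≠ 0 := by
    by_contra! hc
    obtain ⟨x, hx⟩ := hDinf.nonempty
    induction x using Projectivization.ind with | _ z hz
    obtain ⟨-, c, hc0, h1⟩ := key z hz hx
    refine hz (funext fun i => ?_)
    have := h1 i
    rw [hc, map_zero, eq_comm, mul_eq_zero] at this
    exact this.resolve_left hc0
  obtain ⟨-, n, g, u, -, -, -, hu, hucop, hgu⟩ := exists_eq_mul_noCommonFactor _ v hvh hv0
  have key' : ∀ (z : Fin 3 → K) (hz : z ≠ 0), Projectivization.mk K z hz ∈ C.points \ B →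
      eval z (F 0) ≠ 0 ∧ ∃ c : K, c ≠ 0 ∧
        ∀ i, eval ![eval z (F 0), eval z (F 1)] (u i) = c * z i := by
    intro z hz hzD
    obtain ⟨h0, c, hc, h1⟩ := key z hz hzD
    have hg : eval ![eval z (F 0), eval z (F 1)] g ≠ 0 := by
      intro hg
      refine hz (funext fun i => ?_)
      have := h1 i
      rw [hgu, map_mul, hg, zero_mul, eq_comm, mul_eq_zero] at this
      exact this.resolve_left hc
    refine ⟨h0, _, mul_ne_zero (inv_ne_zero hg) hc, fun i => ?_⟩
    rw [mul_assoc, ← h1, hgu, map_mul, inv_mul_cancel_left₀ hg]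
  have hs : ∀ (z : Fin 3 → K), eval z (F 0) ≠ 0 → ![eval z (F 0), eval z (F 1)] ≠ 0 :=
    fun z hz h => hz (congrFun h 0)
  -- The parameters (F₁(z) : F₂(z)) are infinitely many, since `u` recovers `z` from them.
  have hzero : ∀ (Q : MvPolynomial (Fin 2) K) (l : ℕ), Q.IsHomogeneous l →
      (∀ (z : Fin 3 → K) (hz : z ≠ 0), Projectivization.mk K z hz ∈ C.points \ B →
        eval ![eval z (F 0), eval z (F 1)] Q = 0) → Q = 0 := by
    intro Q l hQ h
    refine eq_zero_of_infinite hQ (T := projZeroLocus Q) ?_ subset_rfl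
    refine infinite_of_rel hDinf (fun x t => RatMapsTo u t x) (fun x hx => ?_)
      fun x x' t h h' => h.unique h'
    induction x using Projectivization.ind with | _ z hz
    obtain ⟨h0, c, hc, h1⟩ := key' z hz hx
    exact ⟨Projectivization.mk K _ (hs z h0), (mem_projZeroLocus_mk hQ _ _).2 (h z hz hx),
      (ratMapsTo_mk_iff hu _ _ _ _).2 ⟨c, hc, h1⟩⟩
  have hCu : aeval u C.poly = 0 := by
    refine hzero _ _ (C.homogeneous.aeval u hu) fun z hz hzD => ?_
    obtain ⟨-, c, -, h1⟩ := key' z hz hzD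
    rw [eval_aeval, funext h1, eval_mul_of_isHomogeneous C.homogeneous,
      (mem_projZeroLocus_mk C.homogeneous _ _).1 hzD.1, mul_zero]
  have hFu : ∀ i, (aeval u (F i)).IsHomogeneous (n * 2) := fun i => (hF i).aeval u hu
  have hFuz : ∀ (z : Fin 3 → K) (hz : z ≠ 0), Projectivization.mk K z hz ∈ C.points \ B →
      ∃ c : K, c ≠ 0 ∧ ∀ i, eval ![eval z (F 0), eval z (F 1)] (aeval u (F i)) =
        c * eval z (F i) := by
    intro z hz hzD
    obtain ⟨-, c, hc, h1⟩ := key' z hz hzD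
    refine ⟨c ^ 2, pow_ne_zero _ hc, fun i => ?_⟩
    rw [eval_aeval, funext h1, eval_mul_of_isHomogeneous (hF i)]
  have hFu01 : X 1 * aeval u (F 0) - X 0 * aeval u (F 1) = 0 := by
    refine hzero _ _ (((isHomogeneous_X _ _).mul (hFu 0)).sub
      ((isHomogeneous_X _ _).mul (hFu 1))) fun z hz hzD => ?_
    obtain ⟨c, -, h1⟩ := hFuz z hz hzD
    simp only [map_sub, map_mul, eval_X, h1, Matrix.cons_val_zero, Matrix.cons_val_one]
    ring
  have hFu0 : aeval u (F 0) ≠ 0 := by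
    intro h
    obtain ⟨x, hx⟩ := hDinf.nonempty
    induction x using Projectivization.ind with | _ z hz
    obtain ⟨c, hc, h1⟩ := hFuz z hz hx
    have h2 := h1 0
    rw [h, map_zero, eq_comm, mul_eq_zero] at h2
    exact h2.elim hc (key z hz hx).1
  refine ⟨⟨2, hF 0, hF 1⟩, hcopF, n, u, hu, hucop, fun t x htx => ?_, ?_, ?_⟩
  · refine (mem_projZeroLocus_of_ratMapsTo hu C.homogeneous htx).2 ?_
    rw [hCu]
    exact map_zero _
  · refine (finite_projZeroLocus (hFu 0) hFu0).subset fun t ht => ?_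
    by_contra htF
    refine ht ?_
    induction t using Projectivization.ind with | _ s hs0
    rw [mem_projZeroLocus_mk (hFu 0)] at htF
    have h01 := congrArg (eval s) hFu01
    simp only [map_sub, map_mul, eval_X, map_zero] at h01
    rw [eval_aeval] at htF
    -- If `s 0` vanished, the identity `hFu01` would force `s 1` to vanish too.
    have hsne : s 0 ≠ 0 := by
      intro h
      rw [h, zero_mul, sub_zero, eval_aeval, mul_eq_zero] at h01
      refine hs0 (funext fun i => ?_)
      fin_cases i
      exacts [h, h01.resolve_right htF]
    have hy : (fun i => eval s (u i)) ≠ 0 := by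
      intro h
      apply htF
      have : (fun i => eval s (u i)) = fun i => 0 * (0 : Fin 3 → K) i := by
        rw [h]
        funext i
        simp
      rw [this, eval_mul_of_isHomogeneous (hF 0)]
      simp
    refine ⟨Projectivization.mk K _ hy, (ratMapsTo_mk_iff hu _ _ _ _).2 ⟨1, one_ne_zero, fun i => ?_⟩,
      (ratMapsTo_mk_iff hFp _ _ _ _).2 ⟨_, div_ne_zero htF hsne, fun i => ?_⟩⟩
    · rw [one_mul]
    · rw [eval_aeval, eval_aeval] at h01
      fin_cases i
      · simp only [Fin.zero_eta, Matrix.cons_val_zero]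
        field_simp
      · simp only [Fin.mk_one, Matrix.cons_val_one, Matrix.cons_val_fin_one]
        field_simp
        linear_combination -h01
  · refine hBfin.subset fun x hx => ?_
    obtain ⟨hxC, hx⟩ := hx
    by_contra hxB
    refine hx ?_
    have hxD : x ∈ C.points \ B := ⟨hxC, hxB⟩
    induction x using Projectivization.ind with | _ z hz
    obtain ⟨h0, c, hc, h1⟩ := key' z hz hxD
    refine ⟨Projectivization.mk K _ (hs z h0),
      (ratMapsTo_mk_iff hFp _ _ _ _).2 ⟨1, one_ne_zero, fun i => ?_⟩,
      (ratMapsTo_mk_iff hu _ _ _ _).2 ⟨c, hc, h1⟩⟩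
    fin_cases i <;> simp

end PlaneRational

end

theorem theorem3p7 {K : Type*} [Field K] [IsAlgClosed K]
    (F₁ F₂ F₃ : MvPolynomial (Fin 3) K)
    (hF₁ : F₁.IsHomogeneous 2) (hF₂ : F₂.IsHomogeneous 2)
    (hcop : PlaneRational.NoCommonFactor ![F₁, F₂])
    (hp : PlaneRational.p001 K ∈ PlaneRational.projZeroLocus F₁ ∩ PlaneRational.projZeroLocus F₂)
    (hnondeg : ¬ PlaneRational.IsDegenerateConic (PlaneRational.movingForm F₁ F₂))
    (hquad : PlaneRational.IsQuadraticTransformation ![F₁, F₂, F₃])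
    (C : PlaneRational.PlaneCurve K) (hC : 3 ≤ C.degree) :
    C.ParameterizableBy F₁ F₂ ↔
      ∃ C₀ : PlaneRational.PlaneCurve K,
        C₀.ParameterizableByLines ∧
        PlaneRational.p001 K ∈ C₀.points ∧
        C₀.multiplicity (PlaneRational.p001 K) + 1 = C₀.degree ∧
        C₀.singularPoints ⊆ {PlaneRational.p001 K} ∧
        PlaneRational.zariskiClosure (PlaneRational.ratImage ![F₁, F₂, F₃] C.points) =
          C₀.points := by
  have hF : ∀ i, (![F₁, F₂, F₃] i).IsHomogeneous 2 := hquad.1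
  have : Infinite K := IsAlgClosed.instInfinite
  constructor
  · intro h
    exact PlaneRational.exists_monoidCurve_of_parameterizableBy hF hquad.2.2 C hC h
  · rintro ⟨C₀, ⟨L₁, L₂, -, -, hlines⟩, -, hmult, -, hcl⟩
    -- The parametrization by lines supplies infinitely many points on `C₀`, so the image of `C` is
    -- not finite.
    exact PlaneRational.parameterizableBy_of_closure_eq hF hquad.2.2 hcop C hC C₀
      hlines.infinite_points hmult hcl
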